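/- For a graph $H$ and a family $\mathcal F$ of graphs, let $\mathrm{ex}(n,H,\mathcal F)$ denote the largest number of (not necessarily induced) subgraphs isomorphic to $H$ in an $n$-vertex graph that contains no member of $\mathcal F$ as a (not necessarily induced) subgraph; $C_j$ is the cycle of length $j$. Let $\ell\ge 6$ and $k\ge 3$ be integers, and if $k=3$ assume that $3\mid \ell$. Then \[ \mathrm{ex}(n,C_\ell,\{C_4,C_{2k}\})=O\bigl(n^{\lfloor \ell/3\rfloor}\bigr)\qquad (n\to\infty), \] where the implied constant may depend on $\ell$ and $k$. If moreover $\ell\ne 2k$ and $2k\neq 6$, then this bound is sharp, that is, $\mathrm{ex}(n,C_\ell,\{C_4,C_{2k}\})=\Theta\bigl(n^{\lfloor \ell/3\rfloor}\bigr)$. -/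

import Mathlib

open Asymptotics Filter

/-- A family of (finite) graphs, each given on a vertex set `Fin m`. -/
abbrev GraphFamily : Type := Set (Σ m : ℕ, SimpleGraph (Fin m))

/-- `G` is `𝓕`-free: it contains no member of `𝓕` as a (not necessarily induced) subgraph. -/
def IsFamilyFree {V : Type*} (𝓕 : GraphFamily) (G : SimpleGraph V) : Prop :=
  ∀ F ∈ 𝓕, F.2.Free G

open scoped Classical in
/-- The generalized Turán number `ex(n, H, 𝓕)`: the largest number of copies of `H`
(subgraphs isomorphic to `H`) in an `𝓕`-free graph on `n` vertices. -/
noncomputable def generalizedTuranNumber (n : ℕ) {W : Type*} (H : SimpleGraph W)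
    (𝓕 : GraphFamily) : ℕ :=
  Finset.sup {G : SimpleGraph (Fin n) | IsFamilyFree 𝓕 G} (fun G => G.copyCount H)

/-- The family `{C_4, C_{2k}}`. -/
def cycleFamily (k : ℕ) : GraphFamily :=
  {⟨4, SimpleGraph.cycleGraph 4⟩, ⟨2 * k, SimpleGraph.cycleGraph (2 * k)⟩}

/-! ### Cycles indexed by the integers modulo their length. -/

namespace SimpleGraph

variable {V : Type*} {G : SimpleGraph V}

/-! Lower bound. Arrange `ℓ / 3` bundles in a ring, each consisting of about `n / ℓ` internally
disjoint paths of length 3 between two hubs, and insert `ℓ % 3` further edges. A cycle either uses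
two paths of one bundle, and then has length 6, or runs once around the ring, and then has length
`ℓ`. So `C_4` and `C_{2k}` do not occur when `2k` is neither 6 nor `ℓ`, while choosing one path per
bundle yields `(n / ℓ) ^ (ℓ / 3)` copies of `C_ℓ` (`necklace.free_cycleGraph`,
`necklace.pow_le_copyCount`).

Upper bound. Colour the vertices by `ZMod ℓ`. A given labelled cycle has its `i`-th vertex coloured
`i` for a proportion `ℓ ^ (-ℓ)` of the colourings, so it suffices to bound the cycles coloured in
this way. Call an arc of such a cycle fat if it can be rerouted in many ways while the rest stays
fixed. If at most `ℓ / 3` positions cut the cycle into gaps of length at most 5, none of them fat,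
then the vertices at these positions determine the cycle up to boundedly many choices; this gives
`O(n ^ (ℓ / 3))` cycles (`card_thin_le`). Such positions exist as soon as no two minimal fat arcs
lie in one of finitely many relative positions, called conflicts (`exists_hitting_set`).

Conflicts are rare. If a fixed proportion of the coloured cycles had the same conflict, some
nonempty subfamily could be rerouted along both arcs, within itself, avoiding any bounded set of
vertices. Going back and forth along such reroutings produces paths of many lengths, and closing one
of them gives a `C_{2k}` (`Reroutable.exists_path`, `isContained_of_conflict`). Hence at least half
of the coloured cycles have no conflict.

Two consecutive fat triples yield only even cycles of length at least 8 in this way. They are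
therefore not a conflict for `k = 3`; excluding them is needed only when `3 ∤ ℓ`, which explains the
assumption in that case. -/

theorem cycleGraph_adj_zmod {t : ℕ} (ht : 3 ≤ t) [NeZero t] (e : Fin t ≃ ZMod t)
    (he : ∀ i, e i = ((i : ℕ) : ZMod t)) (u v : Fin t) :
    (cycleGraph t).Adj u v ↔ e u = e v + 1 ∨ e v = e u + 1 := by
  rw [cycleGraph_adj', he, he]
  have h1 : (1 : ZMod t) = ((1 : ℕ) : ZMod t) := by simp
  have key : ∀ a b : Fin t, (a - b).val = 1 ↔ ((a : ℕ) : ZMod t) = ((b : ℕ) : ZMod t) + 1 := by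
    intro a b
    rw [h1, ← Nat.cast_add, ZMod.natCast_eq_natCast_iff', Fin.val_sub]
    have ha := a.2
    have hb := b.2
    rw [Nat.mod_eq_of_lt ha]
    rcases le_or_gt b.val a.val with h | h
    · rw [show t - b.val + a.val = (a.val - b.val) + t by omega, Nat.add_mod_right,
        Nat.mod_eq_of_lt (by omega)]
      rcases Nat.lt_or_ge (b.val + 1) t with h' | h'
      · rw [Nat.mod_eq_of_lt h']; omega
      · rw [show b.val + 1 = t by omega, Nat.mod_self]; omega
    · rw [Nat.mod_eq_of_lt (by omega)]
      rcases Nat.lt_or_ge (b.val + 1) t with h' | h'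
      · rw [Nat.mod_eq_of_lt h']; omega
      · rw [show b.val + 1 = t by omega, Nat.mod_self]; omega
  rw [key, key]

/-- The identification of `Fin t` with the integers modulo `t`. -/
noncomputable def finEquivZMod (t : ℕ) [NeZero t] : Fin t ≃ ZMod t :=
  Equiv.ofBijective (fun i => ((i : ℕ) : ZMod t)) <| by
    rw [Fintype.bijective_iff_injective_and_card]
    refine ⟨fun a b h => ?_, by simp⟩
    have := (ZMod.natCast_eq_natCast_iff' _ _ _).1 h
    rw [Nat.mod_eq_of_lt a.2, Nat.mod_eq_of_lt b.2] at this
    exact Fin.ext this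

theorem finEquivZMod_apply (t : ℕ) [NeZero t] (i : Fin t) :
    finEquivZMod t i = ((i : ℕ) : ZMod t) := rfl

/-- A closed walk along `ZMod t` without repeated vertices is a copy of the `t`-cycle. -/
noncomputable def cycleCopy {t : ℕ} (ht : 3 ≤ t) [NeZero t] (w : ZMod t → V)
    (hw : Function.Injective w) (hadj : ∀ i, G.Adj (w i) (w (i + 1))) : Copy (cycleGraph t) G where
  toHom := ⟨fun i => w (finEquivZMod t i), by
    intro a b hab
    rcases (cycleGraph_adj_zmod ht (finEquivZMod t) (finEquivZMod_apply t) a b).1 hab with h | h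
    · rw [h]; exact (hadj _).symm
    · rw [h]; exact hadj _⟩
  injective' := hw.comp (finEquivZMod t).injective

theorem Copy.zmod_adj {t : ℕ} (ht : 3 ≤ t) [NeZero t] (f : Copy (cycleGraph t) G) (i : ZMod t) :
    G.Adj (f ((finEquivZMod t).symm i)) (f ((finEquivZMod t).symm (i + 1))) := by
  refine f.toHom.map_adj ?_
  rw [cycleGraph_adj_zmod ht (finEquivZMod t) (finEquivZMod_apply t)]
  simp

theorem cycleGraph_isContained_of_list {l : List V} (hl : 3 ≤ l.length) (hnd : l.Nodup)
    (hchain : l.IsChain G.Adj)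
    (hclose : ∀ a ∈ l.getLast?, ∀ b ∈ l.head?, G.Adj a b) :
    (cycleGraph l.length).IsContained G := by
  have : NeZero l.length := ⟨by omega⟩
  refine ⟨⟨⟨l.get, ?_⟩, List.nodup_iff_injective_get.1 hnd⟩⟩
  have key : ∀ a b : Fin l.length,
      finEquivZMod l.length b = finEquivZMod l.length a + 1 → G.Adj (l.get a) (l.get b) := by
    intro a b h
    rw [finEquivZMod_apply, finEquivZMod_apply, show (1 : ZMod l.length) = ((1 : ℕ) : ZMod _) by simp,
      ← Nat.cast_add, ZMod.natCast_eq_natCast_iff', Nat.mod_eq_of_lt b.2] at h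
    rcases Nat.lt_or_ge (a.val + 1) l.length with h' | h'
    · rw [Nat.mod_eq_of_lt h'] at h
      have := List.isChain_iff_getElem.1 hchain a.val h'
      simpa [h] using this
    · have ha : a.val = l.length - 1 := by have := a.2; omega
      rw [show a.val + 1 = l.length by omega, Nat.mod_self] at h
      apply hclose
      · rw [List.getLast?_eq_getElem?]; simp [← ha]
      · rw [List.head?_eq_getElem?]; simp [← h]
  intro a b hab
  rcases (cycleGraph_adj_zmod hl (finEquivZMod _) (finEquivZMod_apply _) a b).1 hab with h | h
  · exact (key _ _ h).symm
  · exact key _ _ h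

end SimpleGraph

/-! ### The necklace graph and the lower bound. -/

/-- The positions of a cyclic necklace of length `ℓ` that are blown up: in each of the first `ℓ / 3`
blocks of three consecutive positions, the last two. -/
def IsFatPos (ℓ : ℕ) (i : ZMod ℓ) : Prop := i.val < 3 * (ℓ / 3) ∧ i.val % 3 ≠ 0

instance (ℓ : ℕ) : DecidablePred (IsFatPos ℓ) := fun _ => inferInstanceAs (Decidable (_ ∧ _))

theorem not_isFatPos_zero (ℓ : ℕ) : ¬IsFatPos ℓ 0 := by simp [IsFatPos]

theorem isFatPos_natCast {ℓ : ℕ} {u : ℕ} (hu : u < ℓ) :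
    IsFatPos ℓ (u : ZMod ℓ) ↔ u < 3 * (ℓ / 3) ∧ u % 3 ≠ 0 := by
  rw [IsFatPos, ZMod.val_natCast, Nat.mod_eq_of_lt hu]

/-- Fat positions come in pairs `3j + 1, 3j + 2` between thin ones. At the end of the ring this
relies on `0` being thin. -/
theorem IsFatPos.forward {ℓ : ℕ} [NeZero ℓ] {i : ZMod ℓ} (hi : ¬IsFatPos ℓ i)
    (h : IsFatPos ℓ (i + 1)) : IsFatPos ℓ (i + 2) ∧ ¬IsFatPos ℓ (i + 3) := by
  obtain ⟨v, hv, hvi⟩ : ∃ v : ℕ, v < ℓ ∧ (v : ZMod ℓ) = i + 1 :=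
    ⟨(i + 1).val, ZMod.val_lt _, by simp⟩
  rw [← hvi, isFatPos_natCast hv] at h
  have hv1 : 1 ≤ v := by
    rcases v with _ | v
    · simp at h
    · omega
  have e0 : i = ((v - 1 : ℕ) : ZMod ℓ) := by
    rw [Nat.cast_sub hv1, hvi]; push_cast; ring
  have e2 : i + 2 = ((v + 1 : ℕ) : ZMod ℓ) := by push_cast; rw [hvi]; ring
  have e3 : i + 3 = ((v + 2 : ℕ) : ZMod ℓ) := by push_cast; rw [hvi]; ring
  rw [e0, isFatPos_natCast (by omega)] at hi
  rw [e2, e3, isFatPos_natCast (by omega)]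
  refine ⟨by omega, ?_⟩
  rcases Nat.lt_or_ge (v + 2) ℓ with h' | h'
  · rw [isFatPos_natCast h']; omega
  · rw [show v + 2 = ℓ by omega, ZMod.natCast_self]; exact not_isFatPos_zero ℓ

theorem IsFatPos.backward {ℓ : ℕ} [NeZero ℓ] {i : ZMod ℓ} (hi : ¬IsFatPos ℓ i)
    (h : IsFatPos ℓ (i - 1)) : IsFatPos ℓ (i - 2) ∧ ¬IsFatPos ℓ (i - 3) := by
  obtain ⟨v, hv, hvi⟩ : ∃ v : ℕ, v < ℓ ∧ (v : ZMod ℓ) = i - 1 :=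
    ⟨(i - 1).val, ZMod.val_lt _, by simp⟩
  rw [← hvi, isFatPos_natCast hv] at h
  have e0 : i = ((v + 1 : ℕ) : ZMod ℓ) := by push_cast; rw [hvi]; ring
  have hv2 : 2 ≤ v := by
    by_contra hlt
    rw [e0, isFatPos_natCast (by omega)] at hi
    omega
  have e2 : i - 2 = ((v - 1 : ℕ) : ZMod ℓ) := by
    rw [Nat.cast_sub (by omega), hvi]; push_cast; ring
  have e3 : i - 3 = ((v - 2 : ℕ) : ZMod ℓ) := by
    rw [Nat.cast_sub hv2, hvi]; push_cast; ring
  have hmod : v % 3 = 2 := by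
    rcases Nat.lt_or_ge (v + 1) ℓ with h' | h'
    · rw [e0, isFatPos_natCast h'] at hi; omega
    · omega
  rw [e2, e3, isFatPos_natCast (by omega), isFatPos_natCast (by omega)]
  omega

/-- The necklace graph: vertex `v` sits at position `v` modulo `ℓ` and is the copy number `v / ℓ` of
that position. Only the copy `0` of a thin position is used, and between two adjacent fat positions
equal copies are joined. -/
def necklace (ℓ n : ℕ) : SimpleGraph (Fin n) where
  Adj u v := u ≠ v ∧
    ((v.val : ZMod ℓ) = (u.val : ZMod ℓ) + 1 ∨ (u.val : ZMod ℓ) = (v.val : ZMod ℓ) + 1) ∧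
    (¬IsFatPos ℓ (u.val : ZMod ℓ) → u.val / ℓ = 0) ∧
    (¬IsFatPos ℓ (v.val : ZMod ℓ) → v.val / ℓ = 0) ∧
    (IsFatPos ℓ (u.val : ZMod ℓ) → IsFatPos ℓ (v.val : ZMod ℓ) → u.val / ℓ = v.val / ℓ)
  symm := ⟨fun _ _ ⟨h, h0, h1, h2, h3⟩ => ⟨h.symm, h0.symm, h2, h1, fun a b => (h3 b a).symm⟩⟩
  loopless := ⟨fun _ h => h.1 rfl⟩

namespace necklace

theorem ext_of_pos {ℓ n : ℕ} {u v : Fin n} (h : (u.val : ZMod ℓ) = (v.val : ZMod ℓ))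
    (h' : u.val / ℓ = v.val / ℓ) : u = v := by
  have := (ZMod.natCast_eq_natCast_iff' _ _ _).1 h
  apply Fin.ext
  rw [← Nat.div_add_mod u.val ℓ, ← Nat.div_add_mod v.val ℓ, this, h']

/-- A non-backtracking walk that leaves a hub into a block runs through this block along one copy. -/
theorem run_through_block {ℓ n : ℕ} [NeZero ℓ] {a b c d : Fin n} (δ : ZMod ℓ) (hδ : δ = 1 ∨ δ = -1)
    (hab : (necklace ℓ n).Adj a b) (hbc : (necklace ℓ n).Adj b c) (hcd : (necklace ℓ n).Adj c d)
    (hac : a ≠ c) (hbd : b ≠ d) (ha : ¬IsFatPos ℓ (a.val : ZMod ℓ))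
    (hb : IsFatPos ℓ (b.val : ZMod ℓ)) (hpos : (b.val : ZMod ℓ) = a.val + δ) :
    (d.val : ZMod ℓ) = a.val + 3 * δ ∧ d.val / ℓ = 0 := by
  have hfat : IsFatPos ℓ ((a.val : ZMod ℓ) + 2 * δ) ∧ ¬IsFatPos ℓ ((a.val : ZMod ℓ) + 3 * δ) := by
    rcases hδ with rfl | rfl
    · rw [hpos] at hb
      simpa using IsFatPos.forward ha hb
    · rw [hpos, ← sub_eq_add_neg] at hb
      have := IsFatPos.backward ha hb
      rwa [show (a.val : ZMod ℓ) + 2 * -1 = a.val - 2 by ring,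
        show (a.val : ZMod ℓ) + 3 * -1 = a.val - 3 by ring]
  have hc : (c.val : ZMod ℓ) = a.val + 2 * δ := by
    have : (c.val : ZMod ℓ) = a.val ∨ (c.val : ZMod ℓ) = a.val + 2 * δ := by
      rcases hδ with rfl | rfl <;> rcases hbc.2.1 with h | h
      · right; rw [h, hpos]; ring
      · left; rw [hpos] at h; exact (add_right_cancel h).symm
      · left; rw [h, hpos]; ring
      · right; rw [hpos] at h; linear_combination -h
    refine this.resolve_left fun h => hac (ext_of_pos h.symm ?_)
    rw [hab.2.2.1 ha, hbc.2.2.2.1 (by rwa [h])]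
  have hcb : b.val / ℓ = c.val / ℓ := hbc.2.2.2.2 hb (by rw [hc]; exact hfat.1)
  have hd : (d.val : ZMod ℓ) = a.val + 3 * δ := by
    have : (d.val : ZMod ℓ) = b.val ∨ (d.val : ZMod ℓ) = a.val + 3 * δ := by
      rcases hδ with rfl | rfl <;> rcases hcd.2.1 with h | h
      · right; rw [h, hc]; ring
      · left; rw [hpos]; rw [hc] at h; linear_combination -h
      · left; rw [h, hc, hpos]; ring
      · right; rw [hc] at h; linear_combination -h
    refine this.resolve_left fun h => hbd (ext_of_pos h.symm ?_)
    rw [hcb, hcd.2.2.2.2 (by rw [hc]; exact hfat.1) (by rwa [h])]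
  exact ⟨hd, hcd.2.2.2.1 (by rw [hd]; exact hfat.2)⟩

/-- A turn must happen at a hub, with two copies of one fat position as neighbours, since otherwise
these neighbours coincide. Both branches then run through the same block to the same opposite hub,
so `w (j - 3) = w (j + 3)`. -/
theorem dvd_six_of_turn {ℓ n t : ℕ} [NeZero ℓ] [NeZero t] (ht : 3 ≤ t) {w : ZMod t → Fin n}
    (hw : Function.Injective w) (hadj : ∀ i, (necklace ℓ n).Adj (w i) (w (i + 1))) (j : ZMod t)
    (hj : ((w (j - 1)).val : ZMod ℓ) = ((w (j + 1)).val : ZMod ℓ)) : t ∣ 6 := by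
  have hcast : ∀ k : ℕ, ∀ i j : ZMod t, j = i + (k : ZMod t) → i = j → t ∣ k := by
    intro k i j h1 h2
    rw [h2] at h1
    exact (ZMod.natCast_eq_zero_iff _ _).1 (by simpa using h1.symm)
  have hne2 : ∀ i j : ZMod t, j = i + 2 → w i ≠ w j := by
    intro i j h e
    have := Nat.le_of_dvd (by norm_num) (hcast 2 i j (by simpa using h) (hw e))
    omega
  have hstep : ∀ i j : ZMod t, j = i + 1 → (necklace ℓ n).Adj (w i) (w j) := by
    rintro i j rfl; exact hadj i
  have A1 := hstep j (j + 1) (by ring)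
  have A0 := (hstep (j - 1) j (by ring)).symm
  have hne := hne2 (j - 1) (j + 1) (by ring)
  have hfat : IsFatPos ℓ ((w (j + 1)).val : ZMod ℓ) := by
    by_contra h
    refine hne (ext_of_pos hj ?_)
    rw [A1.2.2.2.1 h, A0.2.2.2.1 (by rwa [hj])]
  have hthin : ¬IsFatPos ℓ ((w j).val : ZMod ℓ) := by
    intro h
    refine hne (ext_of_pos hj ?_)
    rw [← A1.2.2.2.2 h hfat, A0.2.2.2.2 h (by rwa [hj])]
  obtain ⟨δ, hδ, hpos⟩ : ∃ δ : ZMod ℓ, (δ = 1 ∨ δ = -1) ∧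
      ((w (j + 1)).val : ZMod ℓ) = (w j).val + δ := by
    rcases A1.2.1 with h | h
    · exact ⟨1, Or.inl rfl, h⟩
    · exact ⟨-1, Or.inr rfl, by rw [h]; ring⟩
  have R := run_through_block δ hδ A1 (hstep (j + 1) (j + 2) (by ring))
    (hstep (j + 2) (j + 3) (by ring)) (hne2 _ _ rfl) (hne2 _ _ (by ring)) hthin hfat hpos
  have L := run_through_block δ hδ A0 (hstep (j - 2) (j - 1) (by ring)).symm
    (hstep (j - 3) (j - 2) (by ring)).symm (hne2 _ _ (by ring)).symm (hne2 _ _ (by ring)).symm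
    hthin (by rwa [hj]) (by rw [hj, hpos])
  have := hw (ext_of_pos (L.1.trans R.1.symm) (L.2.trans R.2.symm))
  exact hcast 6 _ _ (by push_cast; ring) this

/-- Without turns the position moves in a constant direction `δ`, so closing up forces `ℓ ∣ t`.
Position `0` is thin and has a single usable vertex, which is met again after `ℓ` steps, so `t ∣ ℓ`.
-/
theorem eq_of_no_turn {ℓ n t : ℕ} [NeZero ℓ] [NeZero t] {w : ZMod t → Fin n}
    (hw : Function.Injective w) (hadj : ∀ i, (necklace ℓ n).Adj (w i) (w (i + 1)))
    (hno : ∀ j, ((w (j - 1)).val : ZMod ℓ) ≠ ((w (j + 1)).val : ZMod ℓ)) : t = ℓ := by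
  obtain ⟨δ, hδ, hpos⟩ : ∃ δ : ZMod ℓ, (δ = 1 ∨ δ = -1) ∧
      ((w 1).val : ZMod ℓ) = (w 0).val + δ := by
    have := (hadj 0).2.1
    rw [zero_add] at this
    rcases this with h | h
    · exact ⟨1, Or.inl rfl, h⟩
    · exact ⟨-1, Or.inr rfl, by rw [h]; ring⟩
  have hstep : ∀ k : ℕ, ((w ((k : ZMod t) + 1)).val : ZMod ℓ) = (w k).val + δ := by
    intro k
    induction k with
    | zero => simpa using hpos
    | succ k ih =>
      have h1 := (hadj ((k : ZMod t) + 1)).2.1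
      have h2 := hno ((k : ZMod t) + 1)
      rw [add_sub_cancel_right] at h2
      push_cast
      rcases hδ with rfl | rfl <;> rcases h1 with h | h
      · exact h
      · exact absurd (add_right_cancel (ih.symm.trans h)) h2
      · refine absurd ?_ h2
        rw [h, ih]; ring
      · rw [h]; ring
  have hall : ∀ k : ℕ, ((w k).val : ZMod ℓ) = (w 0).val + k * δ := by
    intro k
    induction k with
    | zero => simp
    | succ k ih => push_cast; rw [hstep, ih]; ring
  have hδ2 : δ * δ = 1 := by rcases hδ with rfl | rfl <;> ring
  have hℓt : ℓ ∣ t := by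
    have := hall t
    rw [ZMod.natCast_self] at this
    have h0 : (t : ZMod ℓ) * δ = 0 := by simpa using this.symm
    rw [← ZMod.natCast_eq_zero_iff]
    linear_combination δ * h0 - (t : ZMod ℓ) * hδ2
  -- As `δ * δ = 1`, this index is where the walk stands at position `0`.
  obtain ⟨k, hk⟩ : ∃ k : ℕ, ((w k).val : ZMod ℓ) = 0 := by
    refine ⟨(-((w 0).val : ZMod ℓ) * δ).val, ?_⟩
    rw [hall, ZMod.natCast_zmod_val]
    linear_combination -((w 0).val : ZMod ℓ) * hδ2
  have hk' : ((w ((k : ZMod t) + (ℓ : ZMod t))).val : ZMod ℓ) = 0 := by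
    have := hall (k + ℓ)
    rw [Nat.cast_add] at this
    rw [this, ← hk, hall k]; simp
  have hidx : ∀ i, ((w i).val : ZMod ℓ) = 0 → (w i).val / ℓ = 0 := fun i hi =>
    (hadj i).2.2.1 (by rw [hi]; exact not_isFatPos_zero ℓ)
  have := hw (ext_of_pos (hk.trans hk'.symm) ((hidx _ hk).trans (hidx _ hk').symm))
  have htl : t ∣ ℓ := (ZMod.natCast_eq_zero_iff _ _).1 (by simpa using this)
  exact Nat.dvd_antisymm htl hℓt

theorem free_cycleGraph {ℓ n t : ℕ} (hℓ : ℓ ≠ 0) (ht : 3 ≤ t) (h6 : ¬t ∣ 6) (htl : t ≠ ℓ) :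
    (SimpleGraph.cycleGraph t).Free (necklace ℓ n) := by
  rintro ⟨f⟩
  have : NeZero ℓ := ⟨hℓ⟩
  have : NeZero t := ⟨by omega⟩
  have hinj : Function.Injective fun i => f ((SimpleGraph.finEquivZMod t).symm i) :=
    f.injective.comp (SimpleGraph.finEquivZMod t).symm.injective
  by_cases h : ∃ j : ZMod t, ((f ((SimpleGraph.finEquivZMod t).symm (j - 1))).val : ZMod ℓ) =
      ((f ((SimpleGraph.finEquivZMod t).symm (j + 1))).val : ZMod ℓ)
  · obtain ⟨j, hj⟩ := h
    exact h6 (dvd_six_of_turn ht hinj (SimpleGraph.Copy.zmod_adj ht f) j hj)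
  · push Not at h
    exact htl (eq_of_no_turn hinj (SimpleGraph.Copy.zmod_adj ht f) h)

/-- The vertex of the necklace at position `i` on the cycle that uses copy `α j` in block `j`. -/
noncomputable def cycleVertex (ℓ n : ℕ) [NeZero ℓ] (α : ℕ → Fin (n / ℓ)) (i : ZMod ℓ) : Fin n :=
  ⟨(if IsFatPos ℓ i then (α (i.val / 3)).val else 0) * ℓ + i.val, by
    have h1 := (α (i.val / 3)).2
    have h2 := ZMod.val_lt i
    have h3 : (if IsFatPos ℓ i then (α (i.val / 3)).val else 0) + 1 ≤ n / ℓ := by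
      split_ifs <;> omega
    calc _ < ((if IsFatPos ℓ i then (α (i.val / 3)).val else 0) + 1) * ℓ := by
          rw [add_mul]; omega
      _ ≤ n / ℓ * ℓ := Nat.mul_le_mul_right _ h3
      _ ≤ n := Nat.div_mul_le_self _ _⟩

theorem cycleVertex_pos {ℓ n : ℕ} [NeZero ℓ] (α : ℕ → Fin (n / ℓ)) (i : ZMod ℓ) :
    ((cycleVertex ℓ n α i).val : ZMod ℓ) = i := by
  simp [cycleVertex]

theorem cycleVertex_div {ℓ n : ℕ} [NeZero ℓ] (α : ℕ → Fin (n / ℓ)) (i : ZMod ℓ) :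
    (cycleVertex ℓ n α i).val / ℓ = if IsFatPos ℓ i then (α (i.val / 3)).val else 0 := by
  have h2 := ZMod.val_lt i
  simp only [cycleVertex]
  rw [mul_comm, Nat.mul_add_div (by omega), Nat.div_eq_of_lt h2, add_zero]

theorem cycleVertex_injective {ℓ n : ℕ} [NeZero ℓ] (α : ℕ → Fin (n / ℓ)) :
    Function.Injective (cycleVertex ℓ n α) := fun i j h => by
  rw [← cycleVertex_pos α i, h, cycleVertex_pos]

theorem val_div_three_of_isFatPos {ℓ : ℕ} [NeZero ℓ] {i : ZMod ℓ}
    (h' : IsFatPos ℓ (i + 1)) : i.val / 3 = (i + 1).val / 3 := by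
  have hv := ZMod.val_lt i
  have e : i + 1 = ((i.val + 1 : ℕ) : ZMod ℓ) := by simp
  rw [e] at h' ⊢
  have hlt : i.val + 1 < ℓ := by
    by_contra hge
    rw [show i.val + 1 = ℓ by omega, ZMod.natCast_self] at h'
    exact not_isFatPos_zero ℓ h'
  rw [isFatPos_natCast hlt] at h'
  rw [ZMod.val_natCast, Nat.mod_eq_of_lt hlt]
  omega

theorem cycleVertex_adj {ℓ n : ℕ} [NeZero ℓ] (hℓ : 2 ≤ ℓ) (α : ℕ → Fin (n / ℓ)) (i : ZMod ℓ) :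
    (necklace ℓ n).Adj (cycleVertex ℓ n α i) (cycleVertex ℓ n α (i + 1)) := by
  have : Fact (1 < ℓ) := ⟨hℓ⟩
  refine ⟨(cycleVertex_injective α).ne (by simp), ?_⟩
  simp only [cycleVertex_pos, cycleVertex_div]
  refine ⟨Or.inl trivial, fun h => if_neg h, fun h => if_neg h, fun h h' => ?_⟩
  rw [if_pos h, if_pos h', val_div_three_of_isFatPos h']

/-- One cycle for each choice of a path in every bundle; the copy number at position `3j + 1`
recovers the choice in block `j`, so distinct choices give distinct subgraphs. -/
theorem pow_le_copyCount {ℓ n : ℕ} (hℓ : 3 ≤ ℓ) :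
    (n / ℓ) ^ (ℓ / 3) ≤ (necklace ℓ n).copyCount (SimpleGraph.cycleGraph ℓ) := by
  classical
  have : NeZero ℓ := ⟨by omega⟩
  rcases Nat.eq_zero_or_pos (n / ℓ) with h0 | h0
  · rw [h0, zero_pow (by omega)]; exact Nat.zero_le _
  -- The default copy is never read, since every fat position lies in one of the first `ℓ / 3`
  -- blocks.
  let ext : (Fin (ℓ / 3) → Fin (n / ℓ)) → ℕ → Fin (n / ℓ) := fun α j =>
    if h : j < ℓ / 3 then α ⟨j, h⟩ else ⟨0, h0⟩
  let cp : (Fin (ℓ / 3) → Fin (n / ℓ)) → SimpleGraph.Copy (SimpleGraph.cycleGraph ℓ) (necklace ℓ n) :=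
    fun α => SimpleGraph.cycleCopy hℓ (cycleVertex ℓ n (ext α)) (cycleVertex_injective _)
      (cycleVertex_adj (by omega) _)
  have hmem : ∀ α v, v ∈ (cp α).toSubgraph.verts ↔ ∃ i, cycleVertex ℓ n (ext α) i = v := by
    intro α v
    simp only [SimpleGraph.Subgraph.map_verts, SimpleGraph.Subgraph.verts_top, Set.image_univ,
      Set.mem_range]
    constructor
    · rintro ⟨y, rfl⟩; exact ⟨_, rfl⟩
    · rintro ⟨i, rfl⟩
      exact ⟨(SimpleGraph.finEquivZMod ℓ).symm i, by simp [cp, SimpleGraph.cycleCopy]⟩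
  rw [SimpleGraph.copyCount]
  calc (n / ℓ) ^ (ℓ / 3) = Fintype.card (Fin (ℓ / 3) → Fin (n / ℓ)) := by simp
    _ = (Finset.univ : Finset (Fin (ℓ / 3) → Fin (n / ℓ))).card := rfl
    _ ≤ _ := by
      refine Finset.card_le_card_of_injOn (fun α => (cp α).toSubgraph) ?_ ?_
      · intro α _
        simpa using ⟨(cp α).isoToSubgraph⟩
      · intro α _ β _ h
        funext j
        have hj := j.2
        have hlt : 3 * j.val + 1 < ℓ := by omega
        have hfat : IsFatPos ℓ ((3 * j.val + 1 : ℕ) : ZMod ℓ) := by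
          rw [isFatPos_natCast hlt]; omega
        have hv : cycleVertex ℓ n (ext α) ((3 * j.val + 1 : ℕ) : ZMod ℓ) ∈
            (cp β).toSubgraph.verts := by
          rw [← show (cp α).toSubgraph = (cp β).toSubgraph from h, hmem]; exact ⟨_, rfl⟩
        obtain ⟨i, hi⟩ := (hmem β _).1 hv
        have hi' : i = ((3 * j.val + 1 : ℕ) : ZMod ℓ) := by
          rw [← cycleVertex_pos (ext β) i, hi, cycleVertex_pos]
        subst hi'
        have := congrArg (fun v : Fin n => v.val / ℓ) hi
        simp only [cycleVertex_div, if_pos hfat, ZMod.val_natCast, Nat.mod_eq_of_lt hlt] at this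
        rw [show (3 * j.val + 1) / 3 = j.val by omega] at this
        simp only [ext, dif_pos hj] at this
        exact Fin.ext this.symm

end necklace

theorem isBigO_generalizedTuranNumber_cycleGraph {ℓ k : ℕ} (hℓ : 6 ≤ ℓ) (hk : 4 ≤ k)
    (hne : ℓ ≠ 2 * k) :
    (fun n : ℕ => (n : ℝ) ^ (ℓ / 3)) =O[atTop] (fun n : ℕ =>
        (generalizedTuranNumber n (SimpleGraph.cycleGraph ℓ) (cycleFamily k) : ℝ)) := by
  refine IsBigO.of_bound ((2 * ℓ : ℝ) ^ (ℓ / 3)) ?_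
  filter_upwards [eventually_ge_atTop ℓ] with n hn
  have hfree : IsFamilyFree (cycleFamily k) (necklace ℓ n) := by
    rintro F (rfl | rfl)
    · exact necklace.free_cycleGraph (by omega) (by norm_num) (by decide) (show 4 ≠ ℓ by omega)
    · refine necklace.free_cycleGraph (by omega) (show 3 ≤ 2 * k by omega) (fun h => ?_) hne.symm
      have := Nat.le_of_dvd (by norm_num) h
      omega
  have h1 : (n / ℓ) ^ (ℓ / 3) ≤
      generalizedTuranNumber n (SimpleGraph.cycleGraph ℓ) (cycleFamily k) := by
    refine (necklace.pow_le_copyCount (by omega)).trans ?_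
    rw [generalizedTuranNumber]
    exact Finset.le_sup (f := fun G : SimpleGraph (Fin n) => G.copyCount (SimpleGraph.cycleGraph ℓ))
      (by simpa using hfree)
  -- Since `n ≥ ℓ`, rounding `n / ℓ` down costs at most a factor 2.
  have h2 : n ≤ 2 * ℓ * (n / ℓ) := by
    have := Nat.div_add_mod n ℓ
    have h3 := Nat.mod_lt n (show 0 < ℓ by omega)
    have h4 : 1 ≤ n / ℓ := (Nat.one_le_div_iff (by omega)).2 hn
    nlinarith
  have h3 : n ^ (ℓ / 3) ≤ (2 * ℓ) ^ (ℓ / 3) *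
      generalizedTuranNumber n (SimpleGraph.cycleGraph ℓ) (cycleFamily k) := by
    calc n ^ (ℓ / 3) ≤ (2 * ℓ * (n / ℓ)) ^ (ℓ / 3) := Nat.pow_le_pow_left h2 _
      _ = (2 * ℓ) ^ (ℓ / 3) * (n / ℓ) ^ (ℓ / 3) := mul_pow _ _ _
      _ ≤ _ := Nat.mul_le_mul_left _ h1
  rw [Real.norm_of_nonneg (by positivity), Real.norm_of_nonneg (by positivity)]
  exact_mod_cast h3

/-! ### Choosing few positions whose gaps contain no forbidden arc. -/

/-- `GapWalk T a n c`: one can go from `a` to `a + n` in `c` steps of length at most `5`, without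
jumping over an arc of `T`. Here `T j b` says that `b + 1, …, b + j` is an arc of `T`. -/
inductive GapWalk {ℓ : ℕ} (T : ℕ → ZMod ℓ → Prop) : ZMod ℓ → ℕ → ℕ → Prop
  | nil (a : ZMod ℓ) : GapWalk T a 0 0
  | cons {a : ZMod ℓ} {g n c : ℕ} (h1 : 1 ≤ g) (h5 : g ≤ 5)
      (hT : ∀ i j : ℕ, i + j < g → ¬T j (a + i)) (h : GapWalk T (a + g) n c) :
      GapWalk T a (g + n) (c + 1)

namespace GapWalk

variable {ℓ : ℕ} {T : ℕ → ZMod ℓ → Prop}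

theorem append {a a' : ZMod ℓ} {n c n' c' : ℕ} (h : GapWalk T a n c) (ha : a' = a + n)
    (h' : GapWalk T a' n' c') : GapWalk T a (n + n') (c + c') := by
  induction h with
  | nil a => simp only [Nat.cast_zero, add_zero] at ha; subst ha; simpa using h'
  | @cons a g n c h1 h5 hT h ih =>
    rw [show g + n + n' = g + (n + n') by ring, show c + 1 + c' = (c + c') + 1 by ring]
    exact cons h1 h5 hT (ih (by rw [ha]; push_cast; ring))

theorem single {a : ZMod ℓ} {g : ℕ} (h1 : 1 ≤ g) (h5 : g ≤ 5)
    (hT : ∀ i j : ℕ, i + j < g → ¬T j (a + i)) : GapWalk T a g 1 := cons h1 h5 hT (nil _)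

/-- A gap of length 3 has two inner positions, so the only arc of length at least 2 inside it is
that pair. -/
theorem threes (hT2 : ∀ j b, T j b → 2 ≤ j) (q : ℕ) (a : ZMod ℓ)
    (h : ∀ i < q, ¬T 2 (a + ((3 * i : ℕ) : ZMod ℓ))) : GapWalk T a (3 * q) q := by
  induction q generalizing a with
  | zero => exact nil a
  | succ q ih =>
    rw [show 3 * (q + 1) = 3 + 3 * q by ring]
    refine cons (by norm_num) (by norm_num) (fun i j hij hT => ?_) (ih _ fun i hi => ?_)
    · have := hT2 _ _ hT
      obtain ⟨rfl, rfl⟩ : i = 0 ∧ j = 2 := by omega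
      exact h 0 (by omega) (by simpa using hT)
    · have := h (i + 1) (by omega)
      rwa [show a + ((3 : ℕ) : ZMod ℓ) + ((3 * i : ℕ) : ZMod ℓ) =
        a + ((3 * (i + 1) : ℕ) : ZMod ℓ) by push_cast; ring]

theorem four (hT2 : ∀ j b, T j b → 2 ≤ j) {a : ZMod ℓ} (h0 : ¬T 2 a) (h1 : ¬T 2 (a + 1))
    (h2 : ¬T 3 a) : GapWalk T a 4 1 := by
  refine single (by norm_num) (by norm_num) fun i j hij hT => ?_
  have := hT2 _ _ hT
  obtain ⟨rfl, rfl⟩ | ⟨rfl, rfl⟩ | ⟨rfl, rfl⟩ : (i = 0 ∧ j = 2) ∨ (i = 1 ∧ j = 2) ∨ (i = 0 ∧ j = 3) := by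
    omega
  · exact h0 (by simpa using hT)
  · exact h1 (by simpa using hT)
  · exact h2 (by simpa using hT)

/-- The set consists of the starting points of the steps. For `n = ℓ` the end `a + n` is `a` again,
so all gaps close up cyclically. -/
theorem exists_finset [DecidableEq (ZMod ℓ)] {a : ZMod ℓ} {n c : ℕ} (h : GapWalk T a n c) :
    ∃ B : Finset (ZMod ℓ), B.card ≤ c ∧ (a ∈ B ∨ n = 0) ∧ ∀ b ∈ B, ∃ g : ℕ, 1 ≤ g ∧ g ≤ 5 ∧
      (b + g ∈ B ∨ b + g = a + n) ∧ ∀ i j : ℕ, i + j < g → ¬T j (b + i) := by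
  induction h with
  | nil a => exact ⟨∅, by simp⟩
  | @cons a g n c h1 h5 hT h ih =>
    obtain ⟨B, hc, ha, hB⟩ := ih
    refine ⟨insert a B, (Finset.card_insert_le _ _).trans (by omega), by simp, ?_⟩
    intro b hb
    rcases Finset.mem_insert.1 hb with rfl | hb
    · refine ⟨g, h1, h5, ?_, hT⟩
      rcases ha with ha | rfl
      · exact Or.inl (Finset.mem_insert_of_mem ha)
      · right; simp
    · obtain ⟨g', h1', h5', hg', hT'⟩ := hB b hb
      refine ⟨g', h1', h5', hg'.imp Finset.mem_insert_of_mem fun h => ?_, hT'⟩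
      rw [h]; push_cast; ring

end GapWalk

/-- If the arcs of `T` do not overlap or touch in certain ways, some set of at most `ℓ / 3` points
with all gaps at most `5` meets every arc of `T` that is short enough to fit into a gap. -/
theorem exists_hitting_set {ℓ : ℕ} (hℓ : 6 ≤ ℓ) {T : ℕ → ZMod ℓ → Prop}
    (hT2 : ∀ j b, T j b → 2 ≤ j)
    (h22 : ∀ b, T 2 b → ¬T 2 (b + 1)) (h22' : ∀ b, T 2 b → ¬T 2 (b + 2))
    (h23 : ∀ b, T 2 b → ¬T 3 (b + 1)) (h23' : ∀ b, T 2 b → ¬T 3 (b + 2))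
    (h32 : ∀ b, T 3 b → ¬T 2 (b + 3)) (h42 : 7 ≤ ℓ → ∀ b, T 4 b → ¬T 2 (b + 4))
    (h33 : ¬3 ∣ ℓ → ∀ b, T 3 b → ¬T 3 (b + 3)) :
    ∃ B : Finset (ZMod ℓ), B.Nonempty ∧ B.card ≤ ℓ / 3 ∧ ∀ b ∈ B, ∃ g : ℕ, 1 ≤ g ∧ g ≤ 5 ∧
      b + g ∈ B ∧ ∀ i j : ℕ, i + j < g → ¬T j (b + i) := by
  classical
  suffices ∃ a c, c ≤ ℓ / 3 ∧ GapWalk T a ℓ c by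
    obtain ⟨a, c, hc, hw⟩ := this
    obtain ⟨B, hBc, ha, hB⟩ := hw.exists_finset
    have ha : a ∈ B := ha.resolve_right (by omega)
    refine ⟨B, ⟨a, ha⟩, hBc.trans hc, fun b hb => ?_⟩
    obtain ⟨g, h1, h5, hg, hT⟩ := hB b hb
    refine ⟨g, h1, h5, hg.elim id fun h => ?_, hT⟩
    rw [h, ZMod.natCast_self, add_zero]; exact ha
  by_cases hne : ∃ b, T 2 b
  · obtain ⟨b, hb⟩ := hne
    -- Walk from the first position of one arc of length 2 to the first position of the next, at
    -- distance `D`, in `D / 3` steps. The floors add up to at most `n / 3`.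
    have key : ∀ (n : ℕ) (b : ZMod ℓ), T 2 b → T 2 (b + (n : ZMod ℓ)) → ∃ c, c ≤ n / 3 ∧ GapWalk T (b + 1) n c := by
      intro n
      induction n using Nat.strong_induction_on with
      | _ n ih =>
      intro b hb hbn
      rcases Nat.eq_zero_or_pos n with rfl | hn
      · exact ⟨0, le_rfl, .nil _⟩
      have hex : ∃ D : ℕ, 0 < D ∧ T 2 (b + (D : ZMod ℓ)) := ⟨n, hn, hbn⟩
      obtain ⟨D, ⟨hD0, hD⟩, hmin⟩ : ∃ D : ℕ, (0 < D ∧ T 2 (b + (D : ZMod ℓ))) ∧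
          ∀ m : ℕ, 0 < m → m < D → ¬T 2 (b + (m : ZMod ℓ)) :=
        ⟨Nat.find hex, Nat.find_spec hex, fun m h0 hm h => Nat.find_min hex hm ⟨h0, h⟩⟩
      have hDn : D ≤ n := by
        by_contra hlt
        exact hmin n hn (by omega) hbn
      have hmin' : ∀ (m : ℕ) (x : ZMod ℓ), 0 < m → m < D → x = b + (m : ZMod ℓ) → ¬T 2 x := by
        rintro m x h0 h1 rfl; exact hmin m h0 h1
      have h3b : ∀ x, x = b + 1 → ¬T 3 x := by rintro x rfl; exact h23 b hb
      have h3b' : ∀ x, x = b + 2 → ¬T 3 x := by rintro x rfl; exact h23' b hb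
      have hD3 : 3 ≤ D := by
        by_contra hlt
        obtain rfl | rfl : D = 1 ∨ D = 2 := by omega
        · exact h22 b hb (by simpa using hD)
        · exact h22' b hb (by simpa using hD)
      have block : GapWalk T (b + 1) D (D / 3) := by
        rcases Nat.lt_or_ge D 6 with h6 | h6
        · rw [show D / 3 = 1 by omega]
          refine .single (by omega) (by omega) fun i j hij hT => ?_
          have hj := hT2 _ _ hT
          obtain rfl | rfl | ⟨rfl, rfl, rfl⟩ : j = 2 ∨ j = 3 ∨ (j = 4 ∧ i = 0 ∧ D = 5) := by omega
          · exact hmin' (i + 1) _ (by omega) (by omega) (by push_cast; ring) hT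
          · obtain rfl | rfl : i = 0 ∨ i = 1 := by omega
            · exact h3b _ (by simp) hT
            · exact h3b' _ (by push_cast; ring) hT
          · rcases Nat.lt_or_ge ℓ 7 with h7 | h7
            · obtain rfl : ℓ = 6 := by omega
              refine h22 _ hD ?_
              rw [show b + ((5 : ℕ) : ZMod 6) + 1 = b + ((6 : ℕ) : ZMod 6) by push_cast; ring,
                ZMod.natCast_self, add_zero]
              exact hb
            · refine h42 h7 _ hT ?_
              rwa [show b + 1 + ((0 : ℕ) : ZMod ℓ) + 4 = b + ((5 : ℕ) : ZMod ℓ) by push_cast; ring]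
        · obtain ⟨q, r, hr, hq, rfl⟩ : ∃ q r, r < 3 ∧ 2 ≤ q ∧ D = 3 * q + r :=
            ⟨D / 3, D % 3, by omega, by omega, by omega⟩
          have first : GapWalk T (b + 1) 4 1 :=
            .four hT2 (hmin' 1 _ (by omega) (by omega) (by simp))
              (hmin' 2 _ (by omega) (by omega) (by push_cast; ring)) (h3b _ rfl)
          rw [show (3 * q + r) / 3 = q by omega]
          -- The remainder is absorbed by steps of length 4: one at the start, where `h23` excludes
          -- a triple, and for `r = 2` one more at the end, where `h32` excludes it.
          obtain rfl | rfl | rfl : r = 0 ∨ r = 1 ∨ r = 2 := by omega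
          · exact .threes hT2 q _ fun i hi =>
              hmin' (3 * i + 1) _ (by omega) (by omega) (by push_cast; ring)
          · have := first.append rfl (.threes hT2 (q - 1) _ fun i hi =>
              hmin' (3 * i + 5) _ (by omega) (by omega) (by push_cast; ring))
            rwa [show 4 + 3 * (q - 1) = 3 * q + 1 by omega, show 1 + (q - 1) = q by omega] at this
          · have last : GapWalk T (b + 1 + ((4 : ℕ) : ZMod ℓ) + ((3 * (q - 2) : ℕ) : ZMod ℓ)) 4 1 := by
              refine .four hT2 (hmin' (3 * (q - 2) + 5) _ (by omega) (by omega) (by push_cast; ring))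
                (hmin' (3 * (q - 2) + 6) _ (by omega) (by omega) (by push_cast; ring)) fun h => ?_
              refine h32 _ h ?_
              convert hD using 1
              rw [show 3 * q + 2 = 1 + 4 + 3 * (q - 2) + 3 by omega]
              push_cast; ring
            have := (first.append rfl (.threes hT2 (q - 2) _ fun i hi =>
              hmin' (3 * i + 5) _ (by omega) (by omega) (by push_cast; ring))).append
              (by push_cast; ring) last
            rwa [show 4 + 3 * (q - 2) + 4 = 3 * q + 2 by omega,
              show 1 + (q - 2) + 1 = q by omega] at this
      obtain ⟨c, hc, hw⟩ := ih (n - D) (by omega) (b + D) hD (by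
        convert hbn using 1
        rw [Nat.cast_sub hDn]; ring)
      refine ⟨D / 3 + c, by omega, ?_⟩
      have := block.append (by ring) hw
      rwa [show D + (n - D) = n by omega] at this
    obtain ⟨c, hc, hw⟩ := key ℓ b hb (by simpa using hb)
    exact ⟨_, c, hc, hw⟩
  -- Without arcs of length 2 every step of length 3 is allowed; the remainder `r` requires `r`
  -- steps of length 4 that contain no triple.
  · push Not at hne
    obtain ⟨m, r, hr, rfl⟩ : ∃ m r, r < 3 ∧ ℓ = 3 * m + r :=
      ⟨ℓ / 3, ℓ % 3, by omega, by omega⟩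
    rw [show (3 * m + r) / 3 = m by omega]
    have steps : ∀ q a, GapWalk T a (3 * q) q := fun q a => .threes hT2 q a fun i _ => hne _
    have exists_not : r ≠ 0 → ∃ b, ¬T 3 b := fun h0 => by
      by_contra hall
      push Not at hall
      exact h33 (by omega) 0 (hall _) (hall _)
    obtain rfl | rfl | rfl : r = 0 ∨ r = 1 ∨ r = 2 := by omega
    · exact ⟨0, m, le_rfl, steps m 0⟩
    · obtain ⟨b, hb⟩ := exists_not (by norm_num)
      have := (GapWalk.four hT2 (hne _) (hne _) hb).append rfl (steps (m - 1) _)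
      rw [show 4 + 3 * (m - 1) = 3 * m + 1 by omega] at this
      exact ⟨b, _, by omega, this⟩
    -- Otherwise `¬T 3 b` forces `T 3 (b + 4)`, hence `¬T 3 (b + 1)` by `h33`; four such moves
    -- contradict `T 3 (b + 4)`.
    · obtain ⟨b, hb, hb4⟩ : ∃ b, ¬T 3 b ∧ ¬T 3 (b + 4) := by
        by_contra hno
        push Not at hno
        obtain ⟨b, hb⟩ := exists_not (by norm_num)
        have next : ∀ b, ¬T 3 b → ¬T 3 (b + 1) := fun b hb h => by
          refine h33 (by omega) _ h ?_
          rw [show b + 1 + 3 = b + 4 by ring]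
          exact hno b hb
        have := next _ (next _ (next _ (next _ hb)))
        refine this ?_
        rw [show b + 1 + 1 + 1 + 1 = b + 4 by ring]
        exact hno b hb
      have := ((GapWalk.four hT2 (hne _) (hne _) hb).append (by push_cast; ring)
        (GapWalk.four hT2 (hne _) (hne _) hb4)).append rfl (steps (m - 2) _)
      rw [show 4 + 4 + 3 * (m - 2) = 3 * m + 2 by omega] at this
      exact ⟨b, _, by omega, this⟩

/-! ### Arcs of cyclic positions. -/

/-- The arc `b + 1, …, b + n` of the cyclic positions. -/
def cycArc {ℓ : ℕ} (b : ZMod ℓ) (n : ℕ) : Finset (ZMod ℓ) :=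
  (Finset.range n).image fun i : ℕ => b + 1 + i

section cycArc

variable {ℓ : ℕ}

theorem mem_cycArc {b j : ZMod ℓ} {n : ℕ} : j ∈ cycArc b n ↔ ∃ i : ℕ, i < n ∧ b + 1 + i = j := by
  simp [cycArc]

theorem add_natCast_mem_cycArc {b : ZMod ℓ} {m n : ℕ} (h1 : 1 ≤ m) (hm : m ≤ n) :
    b + (m : ZMod ℓ) ∈ cycArc b n :=
  mem_cycArc.2 ⟨m - 1, by omega, by rw [Nat.cast_sub h1]; push_cast; ring⟩

theorem add_natCast_notMem_cycArc {b : ZMod ℓ} {m n : ℕ} (h1 : n < m) (hm : m ≤ ℓ) :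
    b + (m : ZMod ℓ) ∉ cycArc b n := by
  intro h
  obtain ⟨i, hi, h⟩ := mem_cycArc.1 h
  have : ((1 + i : ℕ) : ZMod ℓ) = (m : ZMod ℓ) := by push_cast; linear_combination h
  rw [ZMod.natCast_eq_natCast_iff', Nat.mod_eq_of_lt (by omega)] at this
  rcases hm.lt_or_eq with h' | rfl
  · rw [Nat.mod_eq_of_lt h'] at this; omega
  · rw [Nat.mod_self] at this; omega

theorem self_notMem_cycArc {b : ZMod ℓ} {n : ℕ} (h : n < ℓ) : b ∉ cycArc b n := by
  have := add_natCast_notMem_cycArc (b := b) h le_rfl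
  simpa using this

theorem end_notMem_cycArc {b : ZMod ℓ} {n : ℕ} (h : n < ℓ) : b + n + 1 ∉ cycArc b n := by
  have := add_natCast_notMem_cycArc (b := b) (Nat.lt_succ_self n) h
  rwa [show b + ((n.succ : ℕ) : ZMod ℓ) = b + n + 1 by push_cast; ring] at this

theorem eq_of_mem_cycArc_of_pred_notMem {b j : ZMod ℓ} {n : ℕ} (h : j + 1 ∈ cycArc b n)
    (hj : j ∉ cycArc b n) : j = b := by
  obtain ⟨i, hi, h⟩ := mem_cycArc.1 h
  rcases i with _ | i
  · have : b + 1 = j + 1 := by simpa using h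
    exact (add_right_cancel this).symm
  · exact absurd (mem_cycArc.2 ⟨i, by omega, by push_cast at h; linear_combination h⟩) hj

theorem eq_of_mem_cycArc_of_succ_notMem {b j : ZMod ℓ} {n : ℕ} (h : j ∈ cycArc b n)
    (hj : j + 1 ∉ cycArc b n) : j + 1 = b + n + 1 := by
  obtain ⟨i, hi, h⟩ := mem_cycArc.1 h
  rcases Nat.lt_or_ge (i + 1) n with h' | h'
  · exact absurd (mem_cycArc.2 ⟨i + 1, h', by push_cast; linear_combination h⟩) hj
  · rw [show n = i + 1 by omega]
    push_cast; linear_combination -h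

theorem cycArc_split {b j : ZMod ℓ} {i n : ℕ} (hi : i < n) (h : j ∈ cycArc b n) :
    j ∈ cycArc b i ∨ j = b + 1 + i ∨ j ∈ cycArc (b + 1 + (i : ZMod ℓ)) (n - 1 - i) := by
  obtain ⟨m, hm, rfl⟩ := mem_cycArc.1 h
  rcases lt_trichotomy m i with h' | rfl | h'
  · exact Or.inl (mem_cycArc.2 ⟨m, h', rfl⟩)
  · exact Or.inr (Or.inl rfl)
  · refine Or.inr (Or.inr (mem_cycArc.2 ⟨m - 1 - i, by omega, ?_⟩))
    rw [Nat.cast_sub (by omega), Nat.cast_sub (by omega)]; push_cast; ring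

end cycArc

/-! ### Coloured cycles, fat arcs and richness. -/

section coloredCycles

variable {V : Type*} [Fintype V] {ℓ : ℕ} [NeZero ℓ]

open scoped Classical in
/-- The closed walks of length `ℓ` whose `i`-th vertex has colour `i`. -/
noncomputable def coloredCycles (G : SimpleGraph V) (col : V → ZMod ℓ) : Finset (ZMod ℓ → V) :=
  {x | (∀ i, col (x i) = i) ∧ ∀ i, G.Adj (x i) (x (i + 1))}

open scoped Classical in
/-- The coloured cycles that agree with `x` outside of `A`. -/
noncomputable def variants (G : SimpleGraph V) (col : V → ZMod ℓ) (x : ZMod ℓ → V)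
    (A : Finset (ZMod ℓ)) : Finset (ZMod ℓ → V) :=
  {y ∈ coloredCycles G col | ∀ j ∉ A, y j = x j}

variable {G : SimpleGraph V} {col : V → ZMod ℓ} {x y : ZMod ℓ → V} {A : Finset (ZMod ℓ)}

theorem mem_coloredCycles :
    x ∈ coloredCycles G col ↔ (∀ i, col (x i) = i) ∧ ∀ i, G.Adj (x i) (x (i + 1)) := by
  simp [coloredCycles]

theorem mem_variants :
    y ∈ variants G col x A ↔ y ∈ coloredCycles G col ∧ ∀ j ∉ A, y j = x j := by
  simp [variants]

theorem eq_of_apply_eq_of_mem_coloredCycles (hx : x ∈ coloredCycles G col)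
    (hy : y ∈ coloredCycles G col) {i j : ZMod ℓ} (h : x i = y j) : i = j := by
  rw [← (mem_coloredCycles.1 hx).1 i, h, (mem_coloredCycles.1 hy).1]

/-- The two cycles agree just before and just after the arc, so splicing preserves adjacency; the
colour condition is checked position by position. -/
theorem piecewise_mem_variants (hx : x ∈ coloredCycles G col) (hy : y ∈ coloredCycles G col)
    {b : ZMod ℓ} {n : ℕ} (h0 : x b = y b) (h1 : x (b + n + 1) = y (b + n + 1)) :
    (cycArc b n).piecewise y x ∈ variants G col x (cycArc b n) := by
  rw [mem_coloredCycles] at hx hy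
  refine mem_variants.2 ⟨mem_coloredCycles.2 ⟨fun i => ?_, fun i => ?_⟩, fun j hj => ?_⟩
  · by_cases hi : i ∈ cycArc b n <;> simp [hi, hx.1, hy.1]
  · by_cases hi : i ∈ cycArc b n <;> by_cases hi' : i + 1 ∈ cycArc b n
    · simpa [hi, hi'] using hy.2 i
    · rw [Finset.piecewise_eq_of_mem _ _ _ hi, Finset.piecewise_eq_of_notMem _ _ _ hi']
      have := eq_of_mem_cycArc_of_succ_notMem hi hi'
      rw [this, h1, ← this]
      exact hy.2 i
    · rw [Finset.piecewise_eq_of_notMem _ _ _ hi, Finset.piecewise_eq_of_mem _ _ _ hi',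
        eq_of_mem_cycArc_of_pred_notMem hi' hi, h0]
      exact hy.2 b
    · simpa [hi, hi'] using hx.2 i
  · exact Finset.piecewise_eq_of_notMem _ _ _ hj

/-- The arc of `n` positions after `b` is fat at `x` if it can be rerouted in more than `thr n`
ways. -/
def IsFat (G : SimpleGraph V) (col : V → ZMod ℓ) (thr : ℕ → ℕ) (x : ZMod ℓ → V) (b : ZMod ℓ)
    (n : ℕ) : Prop := thr n < (variants G col x (cycArc b n)).card

/-- A fat arc none of whose proper subarcs is fat. -/
def IsMinFat (G : SimpleGraph V) (col : V → ZMod ℓ) (thr : ℕ → ℕ) (x : ZMod ℓ → V) (b : ZMod ℓ)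
    (n : ℕ) : Prop :=
  IsFat G col thr x b n ∧ ∀ i j : ℕ, i + j ≤ n → j < n → ¬IsFat G col thr x (b + i) j

theorem IsFat.exists_isMinFat {thr : ℕ → ℕ} {b : ZMod ℓ} {n : ℕ} (h : IsFat G col thr x b n) :
    ∃ i j : ℕ, i + j ≤ n ∧ IsMinFat G col thr x (b + i) j := by
  induction n using Nat.strong_induction_on generalizing b with
  | _ n ih =>
    by_cases hm : IsMinFat G col thr x b n
    · exact ⟨0, n, by omega, by simpa using hm⟩
    · rw [IsMinFat, not_and] at hm
      have := hm h
      push Not at this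
      obtain ⟨i, j, hij, hj, hfat⟩ := this
      obtain ⟨i', j', hij', h'⟩ := ih j hj hfat
      refine ⟨i + i', j', by omega, ?_⟩
      rwa [show b + ((i + i' : ℕ) : ZMod ℓ) = b + i + i' by push_cast; ring]

theorem card_variants_cycArc_zero_le (b : ZMod ℓ) : (variants G col x (cycArc b 0)).card ≤ 1 := by
  refine Finset.card_le_one.2 fun y hy z hz => funext fun j => ?_
  have hj : j ∉ cycArc b 0 := by simp [cycArc]
  rw [(mem_variants.1 hy).2 j hj, (mem_variants.1 hz).2 j hj]

/-- Two different middle vertices with the same neighbours form a 4-cycle; the remaining vertices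
are distinct because their colours are. -/
theorem card_variants_cycArc_one_le (hℓ : 3 ≤ ℓ) (h4 : (SimpleGraph.cycleGraph 4).Free G)
    (b : ZMod ℓ) : (variants G col x (cycArc b 1)).card ≤ 1 := by
  refine Finset.card_le_one.2 fun y hy z hz => ?_
  by_contra hne
  obtain ⟨hyF, hyx⟩ := mem_variants.1 hy
  obtain ⟨hzF, hzx⟩ := mem_variants.1 hz
  have hne1 : y (b + 1) ≠ z (b + 1) := by
    intro h
    refine hne (funext fun j => ?_)
    by_cases hj : j ∈ cycArc b 1
    · obtain ⟨i, hi, rfl⟩ := mem_cycArc.1 hj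
      obtain rfl : i = 0 := by omega
      simpa using h
    · rw [hyx j hj, hzx j hj]
  have h0 : y b = z b := by
    rw [hyx b (self_notMem_cycArc (by omega)), hzx b (self_notMem_cycArc (by omega))]
  have h2 : y (b + 1 + 1) = z (b + 1 + 1) := by
    have := end_notMem_cycArc (b := b) (show 1 < ℓ by omega)
    rw [Nat.cast_one] at this
    rw [hyx _ this, hzx _ this]
  have hcol : ∀ m n : ℕ, m < 3 → n < 3 → m ≠ n →
      ∀ u ∈ coloredCycles G col, ∀ v ∈ coloredCycles G col, u (b + m) ≠ v (b + n) := by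
    intro m n hm hn hmn u hu v hv h
    have := add_left_cancel (eq_of_apply_eq_of_mem_coloredCycles hu hv h)
    rw [ZMod.natCast_eq_natCast_iff', Nat.mod_eq_of_lt (by omega), Nat.mod_eq_of_lt (by omega)] at this
    exact hmn this
  have h01 : ∀ u ∈ coloredCycles G col, ∀ v ∈ coloredCycles G col, u b ≠ v (b + 1) := by
    simpa using hcol 0 1 (by norm_num) (by norm_num) (by norm_num)
  have h02 : ∀ u ∈ coloredCycles G col, ∀ v ∈ coloredCycles G col, u b ≠ v (b + 1 + 1) := by
    simpa [add_assoc, one_add_one_eq_two] using hcol 0 2 (by norm_num) (by norm_num) (by norm_num)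
  have h12 : ∀ u ∈ coloredCycles G col, ∀ v ∈ coloredCycles G col, u (b + 1) ≠ v (b + 1 + 1) := by
    simpa [add_assoc, one_add_one_eq_two] using hcol 1 2 (by norm_num) (by norm_num) (by norm_num)
  refine h4 (SimpleGraph.cycleGraph_isContained_of_list
    (l := [y b, y (b + 1), y (b + 1 + 1), z (b + 1)]) (by simp) ?_ ?_ ?_)
  · simp only [List.nodup_cons, List.mem_cons, List.not_mem_nil, or_false, not_or, not_false_eq_true,
      List.nodup_nil, and_true]
    exact ⟨⟨h01 y hyF y hyF, h02 y hyF y hyF, h01 y hyF z hzF⟩, ⟨h12 y hyF y hyF, hne1⟩,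
      (h12 z hzF y hyF).symm⟩
  · simp only [List.isChain_cons_cons, List.isChain_singleton, and_true]
    refine ⟨(mem_coloredCycles.1 hyF).2 _, (mem_coloredCycles.1 hyF).2 _, ?_⟩
    rw [h2]
    exact ((mem_coloredCycles.1 hzF).2 _).symm
  · simp only [List.getLast?_cons_cons, List.getLast?_singleton, Option.mem_def, Option.some.injEq,
      List.head?_cons, forall_eq']
    rw [h0]
    exact ((mem_coloredCycles.1 hzF).2 _).symm

theorem IsMinFat.two_le (hℓ : 3 ≤ ℓ) (h4 : (SimpleGraph.cycleGraph 4).Free G) {thr : ℕ → ℕ}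
    (hthr : ∀ n, 1 ≤ thr n) {b : ZMod ℓ} {n : ℕ} (h : IsMinFat G col thr x b n) : 2 ≤ n := by
  have h1 := hthr n
  have h2 := h.1
  rw [IsFat] at h2
  by_contra hn
  obtain rfl | rfl : n = 0 ∨ n = 1 := by omega
  · have := card_variants_cycArc_zero_le (G := G) (col := col) (x := x) b
    omega
  · have := card_variants_cycArc_one_le (col := col) (x := x) hℓ h4 b
    omega

open scoped Classical in
-- Fixing one inner vertex splits the arc into two proper subarcs, rerouted independently. By
-- minimality neither of them is fat.
theorem IsMinFat.card_filter_le {thr : ℕ → ℕ} {b : ZMod ℓ} {n : ℕ} (hn : n < ℓ)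
    (hx : x ∈ coloredCycles G col) (h : IsMinFat G col thr x b n) {i : ℕ} (hi : i < n) :
    {y ∈ variants G col x (cycArc b n) | y (b + 1 + i) = x (b + 1 + i)}.card ≤
      thr i * thr (n - 1 - i) := by
  have hl : (variants G col x (cycArc b i)).card ≤ thr i := by
    have := h.2 0 i (by omega) hi
    simpa [IsFat] using this
  have hr : (variants G col x (cycArc (b + 1 + i) (n - 1 - i))).card ≤ thr (n - 1 - i) := by
    have := h.2 (1 + i) (n - 1 - i) (by omega) (by omega)
    rw [show b + ((1 + i : ℕ) : ZMod ℓ) = b + 1 + i by push_cast; ring] at this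
    simpa [IsFat] using this
  refine le_trans ?_ (Nat.mul_le_mul hl hr)
  rw [← Finset.card_product]
  have hend : b + 1 + (i : ZMod ℓ) + ((n - 1 - i : ℕ) : ZMod ℓ) + 1 = b + n + 1 := by
    rw [Nat.cast_sub (by omega), Nat.cast_sub (by omega)]; push_cast; ring
  refine Finset.card_le_card_of_injOn (fun y => ((cycArc b i).piecewise y x,
    (cycArc (b + 1 + (i : ZMod ℓ)) (n - 1 - i)).piecewise y x)) ?_ ?_
  · intro y hy
    rw [Finset.mem_coe, Finset.mem_filter, mem_variants] at hy
    obtain ⟨⟨hyF, hyx⟩, hyi⟩ := hy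
    rw [Finset.mem_coe, Finset.mem_product]
    refine ⟨piecewise_mem_variants hx hyF (hyx _ (self_notMem_cycArc hn)).symm ?_,
      piecewise_mem_variants hx hyF hyi.symm ?_⟩
    · rw [show b + (i : ZMod ℓ) + 1 = b + 1 + i by ring]; exact hyi.symm
    · rw [hend]; exact (hyx _ (end_notMem_cycArc hn)).symm
  · intro y hy z hz hyz
    rw [Finset.mem_coe, Finset.mem_filter, mem_variants] at hy hz
    rw [Prod.mk.injEq] at hyz
    funext j
    by_cases hj : j ∈ cycArc b n
    · rcases cycArc_split hi hj with h' | rfl | h'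
      · simpa [h'] using congrFun hyz.1 j
      · rw [hy.2, hz.2]
      · simpa [h'] using congrFun hyz.2 j
    · rw [hy.1.2 j hj, hz.1.2 j hj]

/-- A family of coloured cycles is rich at an arc if every member can be rerouted along this arc,
within the family, so as to avoid any `K` prescribed vertices. -/
def IsRich (K : ℕ) (S : Finset (ZMod ℓ → V)) (b : ZMod ℓ) (n : ℕ) : Prop :=
  ∀ x ∈ S, ∀ Z : Finset V, Z.card ≤ K →
    ∃ y ∈ S, (∀ j ∉ cycArc b n, y j = x j) ∧ ∀ j ∈ cycArc b n, y j ∉ Z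

open scoped Classical in
-- A forbidden vertex can only occur at the position named by its colour, so by minimality it spoils
-- at most `thr (n - 1) ^ 2` reroutings. The `K` forbidden vertices cannot spoil all of them.
theorem isRich_of_card_lt {thr : ℕ → ℕ} (hmono : Monotone thr) {b : ZMod ℓ} {n K : ℕ} (hn : n < ℓ)
    {S : Finset (ZMod ℓ → V)} (hS : S ⊆ coloredCycles G col)
    (hfat : ∀ x ∈ S, IsMinFat G col thr x b n)
    (hcard : ∀ x ∈ S, K * thr (n - 1) ^ 2 < {y ∈ S | ∀ j ∉ cycArc b n, y j = x j}.card) :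
    IsRich K S b n := by
  intro x hx Z hZ
  by_contra hno
  push Not at hno
  refine (hcard x hx).not_ge ?_
  let P : V → Finset (ZMod ℓ → V) := fun z =>
    {y ∈ S | (∀ j ∉ cycArc b n, y j = x j) ∧ col z ∈ cycArc b n ∧ y (col z) = z}
  have hsub : {y ∈ S | ∀ j ∉ cycArc b n, y j = x j} ⊆ Z.biUnion P := by
    intro y hy
    rw [Finset.mem_filter] at hy
    obtain ⟨j, hj, hjZ⟩ := hno y hy.1 hy.2
    have hc := (mem_coloredCycles.1 (hS hy.1)).1 j
    refine Finset.mem_biUnion.2 ⟨y j, hjZ, Finset.mem_filter.2 ⟨hy.1, hy.2, ?_, ?_⟩⟩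
    · rwa [hc]
    · rw [hc]
  have hP : ∀ z ∈ Z, (P z).card ≤ thr (n - 1) ^ 2 := by
    intro z _
    rcases (P z).eq_empty_or_nonempty with h0 | ⟨y, hy⟩
    · rw [h0]; simp
    · rw [Finset.mem_filter] at hy
      obtain ⟨hyS, hyx, hz, hyz⟩ := hy
      obtain ⟨i, hi, hiz⟩ := mem_cycArc.1 hz
      calc (P z).card ≤ {w ∈ variants G col y (cycArc b n) | w (b + 1 + i) = y (b + 1 + i)}.card := by
            refine Finset.card_le_card fun w hw => ?_
            rw [Finset.mem_filter] at hw
            rw [Finset.mem_filter, mem_variants, hiz]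
            exact ⟨⟨hS hw.1, fun j hj => by rw [hw.2.1 j hj, hyx j hj]⟩, by rw [hw.2.2.2, hyz]⟩
        _ ≤ thr i * thr (n - 1 - i) := (hfat y hyS).card_filter_le hn (hS hyS) hi
        _ ≤ thr (n - 1) ^ 2 := by
            rw [sq]
            exact Nat.mul_le_mul (hmono (by omega)) (hmono (by omega))
  calc _ ≤ (Z.biUnion P).card := Finset.card_le_card hsub
    _ ≤ Z.card * thr (n - 1) ^ 2 := Finset.card_biUnion_le_card_mul _ _ _ hP
    _ ≤ K * thr (n - 1) ^ 2 := Nat.mul_le_mul_right _ hZ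

end coloredCycles

/-! ### Passing to a subfamily with large fibres. -/

theorem card_image_filter_ne_add_one_le {α β : Type*} [DecidableEq β] (e : α → β) {S : Finset α}
    {x : α} (hx : x ∈ S) : ({y ∈ S | ¬e y = e x}.image e).card + 1 ≤ (S.image e).card := by
  rw [← Finset.card_erase_add_one (Finset.mem_image_of_mem e hx)]
  refine Nat.add_le_add_right (Finset.card_le_card fun d hd => ?_) 1
  obtain ⟨y, hy, rfl⟩ := Finset.mem_image.1 hd
  rw [Finset.mem_filter] at hy
  exact Finset.mem_erase.2 ⟨hy.2, Finset.mem_image_of_mem e hy.1⟩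

/-- If a finite set is large compared with the number of fibres of two maps, it has a nonempty subset
whose fibres under both maps are all large. -/
theorem exists_subset_large_fibres {α β γ : Type*} [DecidableEq α] [DecidableEq β] [DecidableEq γ]
    (f : α → β) (g : α → γ) (p q : ℕ) (S : Finset α)
    (h : p * (S.image f).card + q * (S.image g).card < S.card) :
    ∃ T ⊆ S, T.Nonempty ∧ ∀ x ∈ T, p < {y ∈ T | f y = f x}.card ∧ q < {y ∈ T | g y = g x}.card := by
  induction S using Finset.strongInduction with
  | H S ih =>
    by_cases hS : ∀ x ∈ S, p < {y ∈ S | f y = f x}.card ∧ q < {y ∈ S | g y = g x}.card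
    · exact ⟨S, subset_rfl, Finset.card_pos.1 (by omega), hS⟩
    push Not at hS
    obtain ⟨x, hx, hsmall⟩ := hS
    -- Deleting a small fibre removes at most `q` (or `p`) elements and at least one value of `g`
    -- (or `f`), so the inequality survives.
    by_cases hp : p < {y ∈ S | f y = f x}.card
    · have hq := hsmall hp
      have hc := Finset.card_filter_add_card_filter_not (s := S) (fun y => g y = g x)
      have h1 := card_image_filter_ne_add_one_le g hx
      have h2 := Finset.card_le_card (Finset.image_subset_image (f := f)
        (Finset.filter_subset (fun y => ¬g y = g x) S))
      obtain ⟨T, hT, hT'⟩ := ih {y ∈ S | ¬g y = g x}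
        (Finset.filter_ssubset.2 ⟨x, hx, by simp⟩) (by nlinarith)
      exact ⟨T, hT.trans (Finset.filter_subset _ _), hT'⟩
    · have hc := Finset.card_filter_add_card_filter_not (s := S) (fun y => f y = f x)
      have h1 := card_image_filter_ne_add_one_le f hx
      have h2 := Finset.card_le_card (Finset.image_subset_image (f := g)
        (Finset.filter_subset (fun y => ¬f y = f x) S))
      obtain ⟨T, hT, hT'⟩ := ih {y ∈ S | ¬f y = f x}
        (Finset.filter_ssubset.2 ⟨x, hx, by simp⟩) (by nlinarith)
      exact ⟨T, hT.trans (Finset.filter_subset _ _), hT'⟩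

/-! ### Building long paths and cycles by repeated rerouting. -/

namespace SimpleGraph

variable {V : Type*} {G : SimpleGraph V}

/-- `a, l, b` is a walk of `G`, with the list `l` of inner vertices. -/
def WalkVia (G : SimpleGraph V) (a : V) (l : List V) (b : V) : Prop :=
  (a :: (l ++ [b])).IsChain G.Adj

theorem WalkVia.append {a v b : V} {l l' : List V} (h : G.WalkVia a l v) (h' : G.WalkVia v l' b) :
    G.WalkVia a (l ++ v :: l') b := by
  have : a :: ((l ++ v :: l') ++ [b]) = (a :: l) ++ v :: (l' ++ [b]) := by simp
  rw [WalkVia, this, List.isChain_split]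
  exact ⟨h, h'⟩

theorem WalkVia.reverse {a b : V} {l : List V} (h : G.WalkVia a l b) : G.WalkVia b l.reverse a := by
  have : b :: (l.reverse ++ [a]) = (a :: (l ++ [b])).reverse := by simp
  rw [WalkVia, this, List.isChain_reverse]
  exact List.IsChain.imp (fun _ _ h => h.symm) h

theorem WalkVia.isContained {a : V} {l : List V} (h : G.WalkVia a l a) (hnd : (a :: l).Nodup)
    (hl : 2 ≤ l.length) : (cycleGraph (l.length + 1)).IsContained G := by
  have hne : l ≠ [] := by rintro rfl; simp at hl
  rw [WalkVia, ← List.cons_append] at h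
  have := cycleGraph_isContained_of_list (l := a :: l) (by simpa using hl) hnd h.left_of_append
    (fun u hu v hv => ?_)
  · simpa using this
  · have hv : a = v := by simpa using hv
    subst hv
    exact (List.isChain_append.1 h).2.2 u hu a (by simp)

/-- The `m` terms of a sequence that follow the term `s`. -/
def segment (x : ℕ → V) (s m : ℕ) : List V := (List.range' (s + 1) m).map x

theorem length_segment (x : ℕ → V) (s m : ℕ) : (segment x s m).length = m := by simp [segment]

theorem mem_segment {x : ℕ → V} {s m : ℕ} {v : V} :
    v ∈ segment x s m ↔ ∃ i, s < i ∧ i ≤ s + m ∧ x i = v := by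
  simp only [segment, List.mem_map, List.mem_range'_1]
  exact ⟨fun ⟨i, h, e⟩ => ⟨i, by omega, by omega, e⟩, fun ⟨i, h1, h2, e⟩ => ⟨i, by omega, e⟩⟩

theorem nodup_segment {x : ℕ → V} {s m t : ℕ} (hx : ∀ i j, i ≤ t → j ≤ t → x i = x j → i = j)
    (h : s + m ≤ t) : (segment x s m).Nodup := by
  refine List.Nodup.map_on (fun i hi j hj => ?_) List.nodup_range'
  rw [List.mem_range'_1] at hi hj
  exact hx i j (by omega) (by omega)

theorem walkVia_segment {x : ℕ → V} (hx : ∀ i, G.Adj (x i) (x (i + 1))) (s m : ℕ) :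
    G.WalkVia (x s) (segment x s m) (x (s + m + 1)) := by
  have : x s :: (segment x s m ++ [x (s + m + 1)]) = (List.range' s (m + 2)).map x := by
    rw [List.range'_succ, List.range'_concat]
    simp [segment, add_assoc, add_comm 1]
  rw [WalkVia, this, List.isChain_iff_getElem]
  intro i hi
  simpa [add_assoc] using hx (s + i)

/-- A family of sequences that start at a common vertex in their term `0` and that can be rerouted
between the terms `0` and `p + 1`, and between the terms `a` and `p + 2`, avoiding any `K` prescribed
vertices. -/
structure Reroutable (G : SimpleGraph V) {ι : Type*} (S : Set ι) (u : ι → ℕ → V) (p a K : ℕ) :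
    Prop where
  one_le : 1 ≤ a
  le : a ≤ p
  adj : ∀ x ∈ S, ∀ i, G.Adj (u x i) (u x (i + 1))
  inj : ∀ x ∈ S, ∀ i j, i ≤ p + 1 → j ≤ p + 1 → u x i = u x j → i = j
  low : ∀ x ∈ S, ∀ Z : Finset V, Z.card ≤ K → ∃ y ∈ S, u y 0 = u x 0 ∧ u y (p + 1) = u x (p + 1) ∧
    ∀ i, 1 ≤ i → i ≤ p → u y i ∉ Z
  high : ∀ x ∈ S, ∀ Z : Finset V, Z.card ≤ K → ∃ y ∈ S, u y 0 = u x 0 ∧ u y a = u x a ∧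
    ∀ i, a < i → i ≤ p + 1 → u y i ∉ Z

namespace Reroutable

variable {ι : Type*} {S : Set ι} {u : ι → ℕ → V} {p a K : ℕ}

/-- In a reroutable family one gets from the term `p + 1` to the term `0` by paths of many lengths. -/
theorem exists_path (h : Reroutable G S u p a K) (j : ℕ) (Z : Finset V)
    (hK : Z.card + 2 * (p + 1) * (j + 1) ≤ K) {x : ι} (hx : x ∈ S) :
    ∃ l : List V, l.length = 2 * (p + 1 - a) * j + p ∧ l.Nodup ∧ (∀ v ∈ l, v ∉ Z) ∧
      G.WalkVia (u x (p + 1)) l (u x 0) := by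
  classical
  induction j generalizing Z x with
  | zero =>
    obtain ⟨y, hy, hy0, hyp, hyZ⟩ := h.low x hx Z (by omega)
    refine ⟨(segment (u y) 0 p).reverse, by simp [length_segment],
      List.nodup_reverse.2 (nodup_segment (h.inj y hy) (by omega)), fun v hv => ?_, ?_⟩
    · rw [List.mem_reverse, mem_segment] at hv
      obtain ⟨i, h0, hi, rfl⟩ := hv
      exact hyZ i h0 (by omega)
    · have := (walkVia_segment (h.adj y hy) 0 p).reverse
      rwa [zero_add, hy0, hyp] at this
  | succ j ih =>
    have ha1 := h.one_le
    have hap := h.le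
    -- Each round adds at most `2 * (p + 1)` vertices to the set to be avoided.
    have hK' : Z.card + 2 * (p + 1) * (j + 1) + 2 * (p + 1) ≤ K := by
      calc _ = Z.card + 2 * (p + 1) * (j + 1 + 1) := by ring
        _ ≤ K := hK
    have hpos : 0 ≤ 2 * (p + 1) * (j + 1) := Nat.zero_le _
    -- One round: descend along a fresh `y` from term `p + 1` to term `a`, then climb back to term
    -- `p + 1` along a fresh `z`. This adds `2 * (p + 1 - a)` vertices and keeps term `0` fixed.
    obtain ⟨y, hy, hy0, hyp, hyZ⟩ := h.low x hx Z (by omega)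
    let Y : Finset V := (segment (u y) 0 (p + 1)).toFinset
    have hY : Y.card ≤ p + 1 := (List.toFinset_card_le _).trans (by rw [length_segment])
    have hZY := Finset.card_union_le Z Y
    obtain ⟨z, hz, hz0, hza, hzZ⟩ := h.high y hy (Z ∪ Y) (by omega)
    let Y' : Finset V := (segment (u z) a (p + 1 - a)).toFinset
    have hY' : Y'.card ≤ p + 1 := (List.toFinset_card_le _).trans (by rw [length_segment]; omega)
    have hZY' := Finset.card_union_le (Z ∪ Y) Y'
    obtain ⟨l, hlen, hnd, hlZ, hl⟩ := ih (Z ∪ Y ∪ Y') (by omega) hz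
    have memY : ∀ i, 1 ≤ i → i ≤ p + 1 → u y i ∈ Y := fun i h1 h2 =>
      List.mem_toFinset.2 (mem_segment.2 ⟨i, by omega, by omega, rfl⟩)
    have memY' : ∀ i, a < i → i ≤ p + 1 → u z i ∈ Y' := fun i h1 h2 =>
      List.mem_toFinset.2 (mem_segment.2 ⟨i, by omega, by omega, rfl⟩)
    refine ⟨(segment (u y) a (p - a)).reverse ++ u y a ::
      (segment (u z) a (p - a) ++ u z (p + 1) :: l), ?_, ?_, ?_, ?_⟩
    · simp only [List.length_append, List.length_reverse, length_segment, List.length_cons, hlen]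
      obtain ⟨d, rfl⟩ := Nat.exists_eq_add_of_le hap
      rw [show a + d - a = d by omega, show a + d + 1 - a = d + 1 by omega]
      ring
    · have hl1 : ∀ i, 1 ≤ i → i ≤ p + 1 → u y i ∉ l := fun i h1 h2 hi =>
        hlZ _ hi (by simp [memY i h1 h2])
      have hl2 : ∀ i, a < i → i ≤ p + 1 → u z i ∉ l := fun i h1 h2 hi =>
        hlZ _ hi (by simp [memY' i h1 h2])
      have hyz : ∀ i j, 1 ≤ i → i ≤ p + 1 → a < j → j ≤ p + 1 → u y i ≠ u z j :=
        fun i j h1 h2 h3 h4 e => hzZ j h3 h4 (by rw [← e]; simp [memY i h1 h2])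
      rw [List.nodup_append', List.nodup_reverse, List.nodup_cons, List.nodup_append',
        List.nodup_cons]
      refine ⟨nodup_segment (h.inj y hy) (by omega), ⟨?_, nodup_segment (h.inj z hz) (by omega),
        ⟨hl2 _ (by omega) le_rfl, hnd⟩, ?_⟩, ?_⟩
      · simp only [List.mem_append, List.mem_cons, mem_segment, not_or, not_exists, not_and]
        exact ⟨fun i h1 h2 e => hyz a i ha1 (by omega) h1 (by omega) e.symm,
          hyz a _ ha1 (by omega) (by omega) le_rfl, hl1 a ha1 (by omega)⟩
      · refine List.disjoint_left.2 fun v hv => ?_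
        obtain ⟨i, h1, h2, rfl⟩ := mem_segment.1 hv
        rw [List.mem_cons, not_or]
        refine ⟨fun e => ?_, hl2 i h1 (by omega)⟩
        have := h.inj z hz _ _ (by omega) (by omega) e
        omega
      · refine List.disjoint_left.2 fun v hv => ?_
        rw [List.mem_reverse] at hv
        obtain ⟨i, h1, h2, rfl⟩ := mem_segment.1 hv
        simp only [List.mem_append, List.mem_cons, mem_segment, not_or, not_exists, not_and]
        refine ⟨fun e => ?_, fun j h3 h4 e => hyz i j (by omega) (by omega) h3 (by omega) e.symm,
          hyz i _ (by omega) (by omega) (by omega) le_rfl, hl1 i (by omega) (by omega)⟩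
        have := h.inj y hy _ _ (by omega) (by omega) e
        omega
    · intro v hv
      simp only [List.mem_append, List.mem_reverse, List.mem_cons, mem_segment] at hv
      rcases hv with ⟨i, h1, h2, rfl⟩ | rfl | ⟨i, h1, h2, rfl⟩ | rfl | hv
      · exact hyZ i (by omega) (by omega)
      · exact hyZ a ha1 hap
      · exact fun hi => hzZ i h1 (by omega) (Finset.mem_union_left _ hi)
      · exact fun hi => hzZ (p + 1) (by omega) le_rfl (Finset.mem_union_left _ hi)
      · exact fun hi => hlZ v hv (by simp [hi])
    · have w1 := (walkVia_segment (h.adj y hy) a (p - a)).reverse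
      have w2 := walkVia_segment (h.adj z hz) a (p - a)
      rw [show a + (p - a) + 1 = p + 1 by omega] at w1 w2
      rw [hyp] at w1
      rw [hza] at w2
      rw [hz0, hy0] at hl
      exact w1.append (w2.append hl)

/-- Closing a path between the terms `0` and `p + 1` to a cycle. -/
theorem isContained_of_path (h : Reroutable G S u p a K) (j : ℕ) {x : ι} (hx : x ∈ S) {w : List V}
    (hw : G.WalkVia (u x 0) w (u x (p + 1))) (hnd : (u x 0 :: (w ++ [u x (p + 1)])).Nodup)
    (hK : w.length + 2 + 2 * (p + 1) * (j + 1) ≤ K) :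
    (cycleGraph (w.length + 2 + 2 * (p + 1 - a) * j + p)).IsContained G := by
  classical
  have h1 := h.one_le
  have h2 := h.le
  have hc : (u x 0 :: (w ++ [u x (p + 1)])).toFinset.card ≤ w.length + 2 :=
    (List.toFinset_card_le _).trans (by simp)
  obtain ⟨l, hlen, hlnd, hlZ, hl⟩ := h.exists_path j (u x 0 :: (w ++ [u x (p + 1)])).toFinset
    (by omega) hx
  have e : u x 0 :: (w ++ u x (p + 1) :: l) = (u x 0 :: (w ++ [u x (p + 1)])) ++ l := by simp
  have := (hw.append hl).isContained (by
    rw [e, List.nodup_append']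
    exact ⟨hnd, hlnd, fun v hv hvl => hlZ v hvl (List.mem_toFinset.2 hv)⟩)
    (by simp only [List.length_append, List.length_cons, hlen]; omega)
  rw [List.length_append, List.length_cons, hlen] at this
  rwa [show w.length + 2 + 2 * (p + 1 - a) * j + p =
    w.length + (2 * (p + 1 - a) * j + p + 1) + 1 by omega]

/-- The path is closed by the initial segment of a member of the family, which has `p` inner
vertices. -/
theorem isContained (h : Reroutable G S u p a K) (j : ℕ) (hS : S.Nonempty)
    (hK : p + 2 + 2 * (p + 1) * (j + 1) ≤ K) :
    (cycleGraph (2 * (p + 1) + 2 * (p + 1 - a) * j)).IsContained G := by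
  obtain ⟨x, hx⟩ := hS
  have hw := walkVia_segment (h.adj x hx) 0 p
  rw [zero_add] at hw
  have e : u x 0 :: (segment (u x) 0 p ++ [u x (p + 1)]) = (List.range' 0 (p + 2)).map (u x) := by
    rw [List.range'_succ, List.range'_concat]
    simp [segment, add_comm]
  have := h.isContained_of_path j hx hw (by
    rw [e]
    refine List.Nodup.map_on (fun i hi j hj => ?_) List.nodup_range'
    rw [List.mem_range'_1] at hi hj
    exact h.inj x hx i j (by omega) (by omega)) (by rw [length_segment]; exact hK)
  rw [length_segment] at this
  rwa [show 2 * (p + 1) + 2 * (p + 1 - a) * j = p + 2 + 2 * (p + 1 - a) * j + p by omega]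

end Reroutable

end SimpleGraph

/-! ### Conflicting rich arcs force a cycle of length `2k`. -/

section Conflicts

variable {V : Type*} [Fintype V] {ℓ : ℕ} [NeZero ℓ] {G : SimpleGraph V} {col : V → ZMod ℓ}
  {S : Finset (ZMod ℓ → V)} {b : ZMod ℓ} {p a n K : ℕ}

theorem eq_of_apply_add_natCast_eq {x y : ZMod ℓ → V} (hx : x ∈ coloredCycles G col)
    (hy : y ∈ coloredCycles G col) {i j : ℕ} (hi : i < ℓ) (hj : j < ℓ)
    (h : x (b + i) = y (b + j)) : i = j := by
  have := add_left_cancel (eq_of_apply_eq_of_mem_coloredCycles hx hy h)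
  rwa [ZMod.natCast_eq_natCast_iff', Nat.mod_eq_of_lt hi, Nat.mod_eq_of_lt hj] at this

theorem reroutable_of_isRich (hS : S ⊆ coloredCycles G col) (h1 : IsRich K S b p)
    (h2 : IsRich K S (b + a) n) (ha : 1 ≤ a) (hap : a ≤ p) (hpn : p + 1 ≤ a + n)
    (hℓ : a + n < ℓ) :
    SimpleGraph.Reroutable G (S : Set (ZMod ℓ → V)) (fun x (i : ℕ) => x (b + i)) p a K where
  one_le := ha
  le := hap
  adj x hx i := by
    have := (mem_coloredCycles.1 (hS hx)).2 (b + i)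
    rwa [add_assoc, ← Nat.cast_add_one] at this
  inj x hx i j hi hj h :=
    eq_of_apply_add_natCast_eq (hS hx) (hS hx) (by omega) (by omega) h
  low x hx Z hZ := by
    obtain ⟨y, hy, hyx, hyZ⟩ := h1 x hx Z hZ
    refine ⟨y, hy, hyx _ ?_, hyx _ (add_natCast_notMem_cycArc (by omega) (by omega)),
      fun i hi hi' => hyZ _ (add_natCast_mem_cycArc hi hi')⟩
    simpa using self_notMem_cycArc (b := b) (show p < ℓ by omega)
  high x hx Z hZ := by
    obtain ⟨y, hy, hyx, hyZ⟩ := h2 x hx Z hZ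
    refine ⟨y, hy, hyx _ ?_, hyx _ (self_notMem_cycArc (by omega)), fun i hi hi' => hyZ _ ?_⟩
    · have := add_natCast_notMem_cycArc (b := b + (a : ZMod ℓ)) (show n < ℓ - a by omega) (by omega)
      rwa [Nat.cast_sub (by omega), ZMod.natCast_self,
        show b + (a : ZMod ℓ) + (0 - a) = b + ((0 : ℕ) : ZMod ℓ) by push_cast; ring] at this
    · have := add_natCast_mem_cycArc (b := b + (a : ZMod ℓ)) (show 1 ≤ i - a by omega)
        (show i - a ≤ n by omega)
      rwa [Nat.cast_sub (by omega), show b + (a : ZMod ℓ) + (i - a) = b + i by ring] at this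

/-- Reading the cycles backwards from the position after the second arc exchanges the roles of the
two arcs, which gives other cycle lengths. -/
theorem reroutable_reverse_of_isRich (hS : S ⊆ coloredCycles G col) (h1 : IsRich K S b p)
    (h2 : IsRich K S (b + a) n) (ha : 1 ≤ a) (hap : a ≤ p) (hpn : p + 1 ≤ a + n)
    (hℓ : a + n < ℓ) :
    SimpleGraph.Reroutable G (S : Set (ZMod ℓ → V))
      (fun x (i : ℕ) => x (b + ((a + n + 1 : ℕ) : ZMod ℓ) - i)) n (a + n - p) K where
  one_le := by omega
  le := by omega
  adj x hx i := by
    have := (mem_coloredCycles.1 (hS hx)).2 (b + ((a + n + 1 : ℕ) : ZMod ℓ) - ((i + 1 : ℕ) : ZMod ℓ))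
    rw [show b + ((a + n + 1 : ℕ) : ZMod ℓ) - ((i + 1 : ℕ) : ZMod ℓ) + 1 =
      b + ((a + n + 1 : ℕ) : ZMod ℓ) - i by push_cast; ring] at this
    exact this.symm
  inj x hx i j hi hj h := by
    have := sub_right_injective (eq_of_apply_eq_of_mem_coloredCycles (hS hx) (hS hx) h)
    rwa [ZMod.natCast_eq_natCast_iff', Nat.mod_eq_of_lt (by omega), Nat.mod_eq_of_lt (by omega)] at this
  low x hx Z hZ := by
    obtain ⟨y, hy, hyx, hyZ⟩ := h2 x hx Z hZ
    refine ⟨y, hy, hyx _ ?_, hyx _ ?_, fun i hi hi' => hyZ _ ?_⟩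
    · have := end_notMem_cycArc (b := b + (a : ZMod ℓ)) (show n < ℓ by omega)
      rwa [show b + (a : ZMod ℓ) + n + 1 = b + ((a + n + 1 : ℕ) : ZMod ℓ) - ((0 : ℕ) : ZMod ℓ) by
        push_cast; ring] at this
    · have := self_notMem_cycArc (b := b + (a : ZMod ℓ)) (show n < ℓ by omega)
      rwa [show b + ((a + n + 1 : ℕ) : ZMod ℓ) - ((n + 1 : ℕ) : ZMod ℓ) = b + a by push_cast; ring]
    · have := add_natCast_mem_cycArc (b := b + (a : ZMod ℓ)) (show 1 ≤ n + 1 - i by omega)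
        (show n + 1 - i ≤ n by omega)
      rwa [Nat.cast_sub (by omega), show b + (a : ZMod ℓ) + (((n + 1 : ℕ) : ZMod ℓ) - i) =
        b + ((a + n + 1 : ℕ) : ZMod ℓ) - i by push_cast; ring] at this
  high x hx Z hZ := by
    obtain ⟨y, hy, hyx, hyZ⟩ := h1 x hx Z hZ
    refine ⟨y, hy, hyx _ ?_, hyx _ ?_, fun i hi hi' => hyZ _ ?_⟩
    · have := add_natCast_notMem_cycArc (b := b) (show p < a + n + 1 by omega) hℓ
      simpa using this
    · have := end_notMem_cycArc (b := b) (show p < ℓ by omega)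
      rwa [Nat.cast_sub (by omega), show b + ((a + n + 1 : ℕ) : ZMod ℓ) - (((a + n : ℕ) : ZMod ℓ) - p) =
        b + p + 1 by push_cast; ring]
    · have := add_natCast_mem_cycArc (b := b) (show 1 ≤ a + n + 1 - i by omega)
        (show a + n + 1 - i ≤ p by omega)
      rwa [Nat.cast_sub (by omega), ← add_sub_assoc] at this

/-- Two pairs shifted by one give only lengths `6 + 4j` by the general construction. The other
residue modulo 4 comes from a longer closing path: follow `x` from `b` to `b + 4`, then step back to
position `b + 3` of a member `y` rerouted on the second pair. -/
theorem isContained_of_overlapping_pairs (hℓ : 6 ≤ ℓ) (hS : S ⊆ coloredCycles G col)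
    (hne : S.Nonempty) (h1 : IsRich K S b 2) (h2 : IsRich K S (b + (1 : ℕ)) 2) (j : ℕ)
    (hK : 6 + 6 * (j + 1) ≤ K) : (SimpleGraph.cycleGraph (8 + 4 * j)).IsContained G := by
  classical
  have hR := reroutable_of_isRich hS h1 h2 le_rfl (by norm_num) (by norm_num) (by omega)
  obtain ⟨x, hx⟩ := hne
  obtain ⟨y, hy, hyx, hyZ⟩ := h2 x hx {x (b + (1 : ℕ)), x (b + (2 : ℕ)), x (b + (3 : ℕ))}
    (Finset.card_le_three.trans (by omega))
  have hcol : ∀ m i : ℕ, m < 6 → i < 6 → m ≠ i →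
      ∀ u ∈ S, ∀ v ∈ S, u (b + m) ≠ v (b + i) := fun m i hm hi hmi u hu v hv h =>
    hmi (eq_of_apply_add_natCast_eq (hS hu) (hS hv) (by omega) (by omega) h)
  have adj : ∀ u ∈ S, ∀ m i : ℕ, i = m + 1 → G.Adj (u (b + m)) (u (b + i)) := by
    rintro u hu m _ rfl
    have := (mem_coloredCycles.1 (hS hu)).2 (b + m)
    rwa [add_assoc, ← Nat.cast_add_one] at this
  have y0 : y (b + (0 : ℕ)) = x (b + (0 : ℕ)) := by
    refine hyx _ ?_
    have := add_natCast_notMem_cycArc (b := b + ((1 : ℕ) : ZMod ℓ)) (show 2 < ℓ - 1 by omega)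
      (by omega)
    rwa [Nat.cast_sub (by omega), ZMod.natCast_self, show b + ((1 : ℕ) : ZMod ℓ) + (0 - (1 : ℕ)) =
      b + ((0 : ℕ) : ZMod ℓ) by push_cast; ring] at this
  have y4 : y (b + (4 : ℕ)) = x (b + (4 : ℕ)) := by
    refine hyx _ ?_
    have := end_notMem_cycArc (b := b + ((1 : ℕ) : ZMod ℓ)) (show 2 < ℓ by omega)
    rwa [show b + ((1 : ℕ) : ZMod ℓ) + ((2 : ℕ) : ZMod ℓ) + 1 = b + ((4 : ℕ) : ZMod ℓ) by
      push_cast; ring] at this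
  have y3 := hyZ (b + (3 : ℕ)) (by
    have := add_natCast_mem_cycArc (b := b + ((1 : ℕ) : ZMod ℓ)) (show 1 ≤ 2 by omega) le_rfl
    rwa [show b + ((1 : ℕ) : ZMod ℓ) + ((2 : ℕ) : ZMod ℓ) = b + ((3 : ℕ) : ZMod ℓ) by
      push_cast; ring] at this)
  simp only [Finset.mem_insert, Finset.mem_singleton, not_or] at y3
  have := hR.isContained_of_path j (x := y) hy
    (w := [x (b + (1 : ℕ)), x (b + (2 : ℕ)), x (b + (3 : ℕ)), x (b + (4 : ℕ))]) ?_ ?_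
    (by simp only [List.length_cons, List.length_nil]; omega)
  · convert this using 2 <;> simp only [List.length_cons, List.length_nil] <;> omega
  · simp only [SimpleGraph.WalkVia, List.cons_append, List.nil_append, List.isChain_cons_cons,
      List.isChain_singleton, and_true]
    refine ⟨?_, adj x hx _ _ rfl, adj x hx _ _ rfl, adj x hx _ _ rfl, ?_⟩
    · rw [y0]; exact adj x hx _ _ rfl
    · rw [← y4]; exact (adj y hy _ _ rfl).symm
  · simp only [List.cons_append, List.nil_append, List.nodup_cons, List.mem_cons, List.not_mem_nil,
      or_false, not_or, not_false_eq_true, List.nodup_nil, and_true]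
    have c := hcol
    refine ⟨⟨?_, ?_, ?_, ?_, ?_⟩, ⟨?_, ?_, ?_, ?_⟩, ⟨?_, ?_, ?_⟩, ⟨?_, ?_⟩, ?_⟩
    all_goals first
      | exact fun h => y3.1 h.symm
      | exact fun h => y3.2.1 h.symm
      | exact fun h => y3.2.2 h.symm
      | exact c _ _ (by norm_num) (by norm_num) (by norm_num) _ hx _ hx
      | exact c _ _ (by norm_num) (by norm_num) (by norm_num) _ hy _ hx
      | exact c _ _ (by norm_num) (by norm_num) (by norm_num) _ hx _ hy
      | exact c _ _ (by norm_num) (by norm_num) (by norm_num) _ hy _ hy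

/-- The relative positions `(p, a, n)` of two arcs of lengths `p` and `n`, the second one starting `a`
steps after the first, that cannot both be rich in a graph without `2k`-cycles. -/
def conflictKinds : Finset (ℕ × ℕ × ℕ) :=
  {(2, 1, 2), (2, 2, 2), (2, 1, 3), (2, 2, 3), (3, 3, 2), (4, 4, 2), (3, 3, 3)}

/-- Reading forwards gives the lengths `2 (p + 1) + 2 (p + 1 - a) j`, reading backwards the same
with `n` and `a + n - p` in place of `p` and `a`. For each kind these, with the special construction
for `(2, 1, 2)`, cover every even length from 6 on, except that `(3, 3, 3)` starts at 8. -/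
theorem isContained_of_conflict {k : ℕ} (hℓ : 6 ≤ ℓ) (hk : 3 ≤ k)
    (hkind : (p, a, n) ∈ conflictKinds) (hlen : a + n < ℓ) (hk4 : p = 3 → n = 3 → 4 ≤ k)
    (hS : S ⊆ coloredCycles G col) (hne : S.Nonempty) (h1 : IsRich (20 * k + 20) S b p)
    (h2 : IsRich (20 * k + 20) S (b + a) n) : (SimpleGraph.cycleGraph (2 * k)).IsContained G := by
  have left := fun ha hap hpn =>
    (reroutable_of_isRich hS h1 h2 ha hap hpn hlen).isContained (hS := hne)
  have right := fun ha hap hpn =>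
    (reroutable_reverse_of_isRich hS h1 h2 ha hap hpn hlen).isContained (hS := hne)
  simp only [conflictKinds, Finset.mem_insert, Finset.mem_singleton, Prod.mk.injEq] at hkind
  rcases hkind with ⟨rfl, rfl, rfl⟩ | ⟨rfl, rfl, rfl⟩ | ⟨rfl, rfl, rfl⟩ | ⟨rfl, rfl, rfl⟩ |
    ⟨rfl, rfl, rfl⟩ | ⟨rfl, rfl, rfl⟩ | ⟨rfl, rfl, rfl⟩
  · obtain ⟨j, rfl | rfl⟩ : ∃ j, k = 3 + 2 * j ∨ k = 4 + 2 * j := ⟨(k - 3) / 2, by omega⟩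
    · have := left (by norm_num) (by norm_num) (by norm_num) j (by omega)
      rwa [show 2 * (3 + 2 * j) = 2 * (2 + 1) + 2 * (2 + 1 - 1) * j by omega]
    · have := isContained_of_overlapping_pairs hℓ hS hne h1 h2 j (by omega)
      rwa [show 2 * (4 + 2 * j) = 8 + 4 * j by omega]
  · have := left (by norm_num) (by norm_num) (by norm_num) (k - 3) (by omega)
    rwa [show 2 * (2 + 1) + 2 * (2 + 1 - 2) * (k - 3) = 2 * k by omega] at this
  · obtain ⟨j, rfl | rfl⟩ : ∃ j, k = 3 + 2 * j ∨ k = 4 + 2 * j := ⟨(k - 3) / 2, by omega⟩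
    · have := left (by norm_num) (by norm_num) (by norm_num) j (by omega)
      rwa [show 2 * (3 + 2 * j) = 2 * (2 + 1) + 2 * (2 + 1 - 1) * j by omega]
    · have := right (by norm_num) (by norm_num) (by norm_num) j (by omega)
      rwa [show 2 * (4 + 2 * j) = 2 * (3 + 1) + 2 * (3 + 1 - (1 + 3 - 2)) * j by omega]
  · have := left (by norm_num) (by norm_num) (by norm_num) (k - 3) (by omega)
    rwa [show 2 * (2 + 1) + 2 * (2 + 1 - 2) * (k - 3) = 2 * k by omega] at this
  · have := right (by norm_num) (by norm_num) (by norm_num) (k - 3) (by omega)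
    rwa [show 2 * (2 + 1) + 2 * (2 + 1 - (3 + 2 - 3)) * (k - 3) = 2 * k by omega] at this
  · have := right (by norm_num) (by norm_num) (by norm_num) (k - 3) (by omega)
    rwa [show 2 * (2 + 1) + 2 * (2 + 1 - (4 + 2 - 4)) * (k - 3) = 2 * k by omega] at this
  · have h4 := hk4 rfl rfl
    have := left (by norm_num) (by norm_num) (by norm_num) (k - 4) (by omega)
    rwa [show 2 * (3 + 1) + 2 * (3 + 1 - 3) * (k - 4) = 2 * k by omega] at this

end Conflicts

/-! ### Counting coloured cycles. -/

/-- The fatness threshold for arcs of `n` positions. -/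
def fatThreshold (K N : ℕ) : ℕ → ℕ
  | 0 => 1
  | n + 1 => N * (K * fatThreshold K N n ^ 2)

theorem one_le_fatThreshold {K N : ℕ} (hK : 1 ≤ K) (hN : 1 ≤ N) (n : ℕ) :
    1 ≤ fatThreshold K N n := by
  induction n with
  | zero => exact le_rfl
  | succ n ih =>
    have : 0 < N * (K * fatThreshold K N n ^ 2) := by positivity
    exact this

theorem monotone_fatThreshold {K N : ℕ} (hK : 1 ≤ K) (hN : 1 ≤ N) :
    Monotone (fatThreshold K N) := by
  refine monotone_nat_of_le_succ fun n => ?_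
  have h1 := one_le_fatThreshold hK hN n
  calc fatThreshold K N n ≤ fatThreshold K N n ^ 2 := Nat.le_self_pow (by norm_num) _
    _ ≤ K * fatThreshold K N n ^ 2 := Nat.le_mul_of_pos_left _ hK
    _ ≤ N * (K * fatThreshold K N n ^ 2) := Nat.le_mul_of_pos_left _ hN

/-- The restriction of a sequence to the complement of `A`. -/
def offArc {V : Type*} {ℓ : ℕ} (A : Finset (ZMod ℓ)) (x : ZMod ℓ → V) : {j // j ∉ A} → V := fun j => x j

theorem offArc_eq_iff {V : Type*} {ℓ : ℕ} {A : Finset (ZMod ℓ)} {x y : ZMod ℓ → V} :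
    offArc A y = offArc A x ↔ ∀ j ∉ A, y j = x j :=
  ⟨fun h j hj => congrFun h ⟨j, hj⟩, fun h => funext fun j => h j.1 j.2⟩

section Counting

variable {V : Type*} [Fintype V] {ℓ : ℕ} [NeZero ℓ] {G : SimpleGraph V} {col : V → ZMod ℓ}

open scoped Classical in
-- The coloured cycles that agree with a given one off a fat arc form a class of more than `thr n`
-- elements, and different classes are disjoint.
theorem mul_card_image_offArc_le {thr : ℕ → ℕ} {b : ZMod ℓ} {n : ℕ} {S : Finset (ZMod ℓ → V)}
    (hS : ∀ x ∈ S, IsFat G col thr x b n) :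
    thr n * (S.image (offArc (cycArc b n))).card ≤ (coloredCycles G col).card := by
  refine (Finset.mul_card_image_le_card_of_maps_to
    (s := {x ∈ coloredCycles G col | offArc (cycArc b n) x ∈ S.image (offArc (cycArc b n))})
    (f := offArc (cycArc b n)) (fun x hx => (Finset.mem_filter.1 hx).2) (thr n) ?_).trans
    (Finset.card_le_card (Finset.filter_subset _ _))
  intro d hd
  obtain ⟨x, hx, rfl⟩ := Finset.mem_image.1 hd
  refine (hS x hx).le.trans (Finset.card_le_card fun y hy => ?_)
  rw [mem_variants] at hy
  have := offArc_eq_iff.2 hy.2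
  rw [Finset.mem_filter, Finset.mem_filter, this]
  exact ⟨⟨hy.1, hd⟩, rfl⟩

open scoped Classical in
-- If the conflict were more frequent, the recursion for `fatThreshold` would provide exactly the
-- inequality of `exists_subset_large_fibres`. The resulting subfamily is rich at both arcs, which
-- gives a `C_{2k}`.
theorem card_conflict_mul_le {k p a n N : ℕ} (hN : 1 ≤ N) (hℓ : 6 ≤ ℓ) (hk : 3 ≤ k)
    (hG : (SimpleGraph.cycleGraph (2 * k)).Free G)
    (hkind : (p, a, n) ∈ conflictKinds) (hlen : a + n < ℓ) (hk4 : p = 3 → n = 3 → 4 ≤ k)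
    (b : ZMod ℓ) :
    {x ∈ coloredCycles G col | IsMinFat G col (fatThreshold (20 * k + 20) N) x b p ∧
      IsMinFat G col (fatThreshold (20 * k + 20) N) x (b + a) n}.card * N ≤
      2 * (coloredCycles G col).card := by
  have hbound : p < ℓ ∧ n < ℓ ∧ 1 ≤ p ∧ 1 ≤ n := by
    simp only [conflictKinds, Finset.mem_insert, Finset.mem_singleton, Prod.mk.injEq] at hkind
    omega
  obtain ⟨hp, hn, hp1, hn1⟩ := hbound
  set K := 20 * k + 20 with hKdef
  set thr := fatThreshold K N with hthr
  set S : Finset (ZMod ℓ → V) := {x ∈ coloredCycles G col | IsMinFat G col thr x b p ∧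
    IsMinFat G col thr x (b + a) n} with hSdef
  have hS : ∀ x ∈ S, x ∈ coloredCycles G col ∧ IsMinFat G col thr x b p ∧
      IsMinFat G col thr x (b + a) n := fun x hx => Finset.mem_filter.1 hx
  by_contra hlt
  push Not at hlt
  have i1 := mul_card_image_offArc_le (fun x hx => (hS x hx).2.1.1)
  have i2 := mul_card_image_offArc_le (fun x hx => (hS x hx).2.2.1)
  have e : ∀ m, 1 ≤ m → thr m = N * (K * thr (m - 1) ^ 2) := by
    intro m hm
    obtain ⟨m, rfl⟩ := Nat.exists_eq_add_of_le' hm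
    rfl
  rw [e p hp1] at i1
  rw [e n hn1] at i2
  obtain ⟨T, hTS, hTne, hT⟩ := exists_subset_large_fibres (offArc (cycArc b p))
    (offArc (cycArc (b + (a : ZMod ℓ)) n)) (K * thr (p - 1) ^ 2) (K * thr (n - 1) ^ 2) S (by
      refine Nat.lt_of_mul_lt_mul_left (a := N) ?_
      nlinarith)
  have hmono : Monotone thr := monotone_fatThreshold (by omega) hN
  have hTF : T ⊆ coloredCycles G col := fun x hx => (hS x (hTS hx)).1
  refine hG (isContained_of_conflict (b := b) hℓ hk hkind hlen hk4 hTF hTne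
    (isRich_of_card_lt hmono hp hTF (fun x hx => (hS x (hTS hx)).2.1) fun x hx => ?_)
    (isRich_of_card_lt hmono hn hTF (fun x hx => (hS x (hTS hx)).2.2) fun x hx => ?_))
  · simpa only [offArc_eq_iff] using (hT x hx).1
  · simpa only [offArc_eq_iff] using (hT x hx).2

/-- The gap structures on the cyclic positions: a set `B` of positions and a gap after each of them. -/
def IsGapStructure (B : Finset (ZMod ℓ)) (g : ZMod ℓ → Fin 6) : Prop :=
  B.Nonempty ∧ ∀ b ∈ B, 1 ≤ (g b).val ∧ b + ((g b).val : ZMod ℓ) ∈ B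

/-- Starting at a point of `B` and moving one position at a time, one always stays in `B` or inside
a gap, and this reaches every position. -/
theorem IsGapStructure.mem_or {B : Finset (ZMod ℓ)} {g : ZMod ℓ → Fin 6} (h : IsGapStructure B g)
    (j : ZMod ℓ) : j ∈ B ∨ ∃ b ∈ B, j ∈ cycArc b ((g b).val - 1) := by
  obtain ⟨⟨b₀, hb₀⟩, hB⟩ := h
  have key : ∀ m : ℕ, b₀ + (m : ZMod ℓ) ∈ B ∨
      ∃ b ∈ B, b₀ + (m : ZMod ℓ) ∈ cycArc b ((g b).val - 1) := by
    intro m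
    induction m with
    | zero => left; simpa using hb₀
    | succ m ih =>
      have step : ∀ b ∈ B, ∀ i : ℕ, i < (g b).val → b₀ + ((m + 1 : ℕ) : ZMod ℓ) = b + 1 + i →
          b₀ + ((m + 1 : ℕ) : ZMod ℓ) ∈ B ∨
            ∃ b ∈ B, b₀ + ((m + 1 : ℕ) : ZMod ℓ) ∈ cycArc b ((g b).val - 1) := by
        intro b hb i hi he
        obtain ⟨h1, h2⟩ := hB b hb
        rcases Nat.lt_or_ge i ((g b).val - 1) with h' | h'
        · exact Or.inr ⟨b, hb, mem_cycArc.2 ⟨i, h', he.symm⟩⟩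
        · left
          rw [show (g b).val = i + 1 by omega] at h2
          rw [he]
          rwa [show b + 1 + (i : ZMod ℓ) = b + ((i + 1 : ℕ) : ZMod ℓ) by push_cast; ring]
      rcases ih with h | ⟨b, hb, h⟩
      · exact step _ h 0 (hB _ h).1 (by push_cast; ring)
      · obtain ⟨i, hi, he⟩ := mem_cycArc.1 h
        exact step b hb (i + 1) (by omega) (by push_cast; rw [← add_assoc, ← he]; ring)
  have := key (j - b₀).val
  rwa [ZMod.natCast_zmod_val, add_sub_cancel] at this

open scoped Classical in
/-- The coloured cycles all of whose gaps with respect to a gap structure are thin are determined up to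
boundedly many choices by the vertices at the positions of the gap structure. -/
theorem card_thin_le {B : Finset (ZMod ℓ)} {g : ZMod ℓ → Fin 6} (h : IsGapStructure B g) (C : ℕ) :
    {x ∈ coloredCycles G col | ∀ b ∈ B,
      (variants G col x (cycArc b ((g b).val - 1))).card ≤ C}.card ≤
      (C * Fintype.card V) ^ B.card := by
  set S : Finset (ZMod ℓ → V) := {x ∈ coloredCycles G col | ∀ b ∈ B,
      (variants G col x (cycArc b ((g b).val - 1))).card ≤ C}
  let r : (ZMod ℓ → V) → (B → V) := fun x b => x b
  have himg : (S.image r).card ≤ Fintype.card V ^ B.card := by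
    refine (Finset.card_le_univ _).trans ?_
    simp
  rw [mul_pow]
  refine (Finset.card_le_mul_card_image (f := r) S (C ^ B.card) fun d hd => ?_).trans
    (Nat.mul_le_mul_left _ himg)
  obtain ⟨x, hx, rfl⟩ := Finset.mem_image.1 hd
  obtain ⟨hxF, hxC⟩ := Finset.mem_filter.1 hx
  have hr : ∀ y ∈ ({y ∈ S | r y = r x} : Finset _), y ∈ coloredCycles G col ∧ ∀ b ∈ B, y b = x b :=
    fun y hy => ⟨(Finset.mem_filter.1 (Finset.mem_filter.1 hy).1).1,
      fun b hb => congrFun (Finset.mem_filter.1 hy).2 ⟨b, hb⟩⟩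
  calc ({y ∈ S | r y = r x} : Finset _).card
      ≤ (Fintype.piFinset fun b : B => variants G col x (cycArc b.1 ((g b.1).val - 1))).card := by
        refine Finset.card_le_card_of_injOn
          (fun y (b : B) => (cycArc b.1 ((g b.1).val - 1)).piecewise y x) ?_ ?_
        · intro y hy
          obtain ⟨hyF, hyx⟩ := hr y hy
          rw [Finset.mem_coe, Fintype.mem_piFinset]
          rintro ⟨b, hb⟩
          refine piecewise_mem_variants hxF hyF (hyx b hb).symm ?_
          obtain ⟨h1, h2⟩ := h.2 b hb
          rw [Nat.cast_sub h1, show b + (((g b).val : ZMod ℓ) - ((1 : ℕ) : ZMod ℓ)) + 1 =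
            b + ((g b).val : ZMod ℓ) by push_cast; ring]
          exact (hyx _ h2).symm
        · intro y hy z hz hyz
          funext j
          rcases h.mem_or j with hj | ⟨b, hb, hj⟩
          · rw [(hr y hy).2 j hj, (hr z hz).2 j hj]
          · have := congrFun (congrFun hyz ⟨b, hb⟩) j
            simpa [hj] using this
    _ ≤ C ^ B.card := by
        rw [Fintype.card_piFinset]
        refine (Finset.prod_le_pow_card _ _ C fun b _ => hxC b.1 b.2).trans ?_
        simp

open scoped Classical in
-- There are at most `7 * ℓ` placed conflicts, each in at most `2 / N` of the coloured cycles, so `N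
-- = 28 * ℓ` leaves at least half of them free of conflicts. Those are covered by the gap
-- structures, at most `2 ^ ℓ * 6 ^ ℓ` in number.
theorem card_coloredCycles_le [Nonempty V] {k : ℕ} (hℓ : 6 ≤ ℓ) (hk : 3 ≤ k)
    (hk3 : k = 3 → 3 ∣ ℓ) (h4 : (SimpleGraph.cycleGraph 4).Free G)
    (hG : (SimpleGraph.cycleGraph (2 * k)).Free G) :
    (coloredCycles G col).card ≤ 2 * (2 ^ ℓ * 6 ^ ℓ *
      (fatThreshold (20 * k + 20) (28 * ℓ) 4 * Fintype.card V) ^ (ℓ / 3)) := by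
  set N := 28 * ℓ with hN
  set thr := fatThreshold (20 * k + 20) N with hthr
  have hmono : Monotone thr := monotone_fatThreshold (by omega) (by omega)
  have hone : ∀ n, 1 ≤ thr n := one_le_fatThreshold (by omega) (by omega)
  set F := coloredCycles G col with hF
  let kinds : Finset (ZMod ℓ × ℕ × ℕ × ℕ) := Finset.univ ×ˢ
    {t ∈ conflictKinds | t.2.1 + t.2.2 < ℓ ∧ (t.1 = 3 → t.2.2 = 3 → 4 ≤ k)}
  let P : ZMod ℓ × ℕ × ℕ × ℕ → Finset (ZMod ℓ → V) := fun t =>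
    {x ∈ F | IsMinFat G col thr x t.1 t.2.1 ∧ IsMinFat G col thr x (t.1 + (t.2.2.1 : ZMod ℓ)) t.2.2.2}
  have hkinds : kinds.card ≤ 7 * ℓ := by
    rw [Finset.card_product, Finset.card_univ, ZMod.card, mul_comm]
    refine Nat.mul_le_mul_right _ ((Finset.card_le_card (Finset.filter_subset _ _)).trans ?_)
    decide
  have hP : ∀ t ∈ kinds, (P t).card * N ≤ 2 * F.card := by
    rintro ⟨b, p, a, n⟩ ht
    simp only [kinds, Finset.mem_product, Finset.mem_univ, true_and, Finset.mem_filter] at ht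
    exact card_conflict_mul_le (by omega) hℓ hk hG ht.1 ht.2.1 ht.2.2 b
  have hbad : 2 * (kinds.biUnion P).card ≤ F.card := by
    have h1 : (kinds.biUnion P).card * N ≤ 7 * ℓ * (2 * F.card) := by
      calc (kinds.biUnion P).card * N ≤ (∑ t ∈ kinds, (P t).card) * N :=
            Nat.mul_le_mul_right _ Finset.card_biUnion_le
        _ = ∑ t ∈ kinds, (P t).card * N := Finset.sum_mul _ _ _
        _ ≤ kinds.card * (2 * F.card) := by
            rw [← smul_eq_mul]; exact Finset.sum_le_card_nsmul _ _ _ hP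
        _ ≤ _ := Nat.mul_le_mul_right _ hkinds
    have hpos : 0 < 14 * ℓ := by omega
    refine Nat.le_of_mul_le_mul_left ?_ hpos
    rw [hN] at h1
    nlinarith
  let Q : Finset (ZMod ℓ) × (ZMod ℓ → Fin 6) → Finset (ZMod ℓ → V) := fun s =>
    {x ∈ F | ∀ b ∈ s.1, (variants G col x (cycArc b ((s.2 b).val - 1))).card ≤ thr 4}
  let structures : Finset (Finset (ZMod ℓ) × (ZMod ℓ → Fin 6)) :=
    {s | IsGapStructure s.1 s.2 ∧ s.1.card ≤ ℓ / 3}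
  have hcover : F ⊆ kinds.biUnion P ∪ structures.biUnion Q := by
    intro x hx
    rw [Finset.mem_union]
    by_cases hxP : x ∈ kinds.biUnion P
    · exact Or.inl hxP
    right
    have hno : ∀ p a n : ℕ, (p, a, n) ∈ conflictKinds → a + n < ℓ → (p = 3 → n = 3 → 4 ≤ k) →
        ∀ b, IsMinFat G col thr x b p → ¬IsMinFat G col thr x (b + (a : ZMod ℓ)) n := by
      intro p a n hkind hlen hk4 b h1 h2
      refine hxP (Finset.mem_biUnion.2 ⟨(b, p, a, n), ?_, Finset.mem_filter.2 ⟨hx, h1, h2⟩⟩)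
      simp only [kinds, Finset.mem_product, Finset.mem_univ, true_and, Finset.mem_filter]
      exact ⟨hkind, hlen, hk4⟩
    have rule : ∀ p a n : ℕ, (p, a, n) ∈ conflictKinds → a + n < ℓ → (p = 3 → n = 3 → 4 ≤ k) →
        ∀ c : ZMod ℓ, c = (a : ZMod ℓ) → ∀ b, IsMinFat G col thr x b p →
          ¬IsMinFat G col thr x (b + c) n := by
      rintro p a n h1 h2 h3 _ rfl; exact hno p a n h1 h2 h3
    obtain ⟨B, hne, hBc, hB⟩ := exists_hitting_set hℓ (T := fun j b => IsMinFat G col thr x b j)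
      (fun j b h => h.two_le (by omega) h4 hone)
      (rule 2 1 2 (by decide) (by omega) (by omega) _ (by simp))
      (rule 2 2 2 (by decide) (by omega) (by omega) _ (by simp))
      (rule 2 1 3 (by decide) (by omega) (by omega) _ (by simp))
      (rule 2 2 3 (by decide) (by omega) (by omega) _ (by simp))
      (rule 3 3 2 (by decide) (by omega) (by omega) _ (by simp))
      (fun h7 => rule 4 4 2 (by decide) (by omega) (by omega) _ (by simp))
      (fun h3 => rule 3 3 3 (by decide) (by omega) (by
        have : k ≠ 3 := fun h => h3 (hk3 h)
        omega) _ (by simp))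
    choose! g hg using hB
    -- The default gap `0` only concerns positions outside `B`.
    refine Finset.mem_biUnion.2 ⟨(B, fun b => if h : g b < 6 then ⟨g b, h⟩ else 0), ?_, ?_⟩
    · refine Finset.mem_filter.2 ⟨Finset.mem_univ _, ⟨hne, fun b hb => ?_⟩, hBc⟩
      obtain ⟨h1, h5, h2, -⟩ := hg b hb
      simp only [dif_pos (show g b < 6 by omega)]
      exact ⟨h1, h2⟩
    · refine Finset.mem_filter.2 ⟨hx, fun b hb => ?_⟩
      obtain ⟨h1, h5, -, h3⟩ := hg b hb
      simp only [dif_pos (show g b < 6 by omega)]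
      -- A gap has at most 4 inner positions, so more than `thr 4` variants would make it fat; it
      -- would then contain a minimal fat arc.
      by_contra hlt
      have hfat : IsFat G col thr x b (g b - 1) :=
        lt_of_le_of_lt (hmono (by omega)) (not_le.1 hlt)
      obtain ⟨i, j, hij, hmin⟩ := hfat.exists_isMinFat
      exact h3 i j (by omega) hmin
  have hgood : (structures.biUnion Q).card ≤ 2 ^ ℓ * 6 ^ ℓ * (thr 4 * Fintype.card V) ^ (ℓ / 3) := by
    refine (Finset.card_biUnion_le_card_mul _ _ ((thr 4 * Fintype.card V) ^ (ℓ / 3))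
      fun s hs => ?_).trans (Nat.mul_le_mul_right _ ?_)
    · obtain ⟨-, h1, h2⟩ := Finset.mem_filter.1 hs
      exact (card_thin_le h1 _).trans
        (Nat.pow_le_pow_right (Nat.mul_pos (hone 4) Fintype.card_pos) h2)
    · refine (Finset.card_le_univ _).trans ?_
      simp [ZMod.card]
  have h1 := Finset.card_le_card hcover
  have h2 := Finset.card_union_le (kinds.biUnion P) (structures.biUnion Q)
  omega

end Counting

/-! ### Averaging over colourings, and the theorem. -/

/-- Every injective sequence is properly coloured by a fixed proportion of all colourings. -/
theorem card_colorings_le {V : Type*} [Fintype V] [DecidableEq V] {ℓ : ℕ} [NeZero ℓ]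
    {x : ZMod ℓ → V} (hx : Function.Injective x) :
    Fintype.card (V → ZMod ℓ) ≤
      (Finset.univ.filter fun col : V → ZMod ℓ => ∀ i, col (x i) = i).card * ℓ ^ ℓ := by
  have h := Finset.card_le_mul_card_image (f := fun col : V → ZMod ℓ => col ∘ x) Finset.univ
    (Finset.univ.filter fun col : V → ZMod ℓ => ∀ i, col (x i) = i).card fun τ _ => ?_
  · refine h.trans (Nat.mul_le_mul_left _ ((Finset.card_le_univ _).trans ?_))
    simp [ZMod.card]
  -- Shifting the colour of `x i` by `i - τ i` injects the colourings with pattern `τ` along `x`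
  -- into the proper ones; there are `ℓ ^ ℓ` patterns.
  · refine Finset.card_le_card_of_injOn
      (fun col v => col v + Function.extend x (fun i => i - τ i) 0 v) ?_ ?_
    · intro col hcol
      have hcol : col ∘ x = τ := by simpa using hcol
      simp only [Finset.coe_filter, Finset.mem_univ, true_and, Set.mem_ofPred_eq]
      intro i
      rw [hx.extend_apply, ← hcol]
      simp
    · intro c _ c' _ h
      funext v
      exact add_right_cancel (congrFun h v)

theorem labelledCopyCount_le_card {V W β : Type*} [Fintype V] [Fintype W] {G : SimpleGraph V}
    {H : SimpleGraph W} {I : Finset β} (F : SimpleGraph.Copy H G → β) (hF : Function.Injective F)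
    (hI : ∀ f, F f ∈ I) : G.labelledCopyCount H ≤ I.card := by
  classical
  rw [SimpleGraph.labelledCopyCount, ← Finset.card_univ]
  exact Finset.card_le_card_of_injOn F (fun f _ => hI f) hF.injOn

open scoped Classical in
-- Double counting of pairs of a labelled cycle and a colouring that is proper on it.
theorem labelledCopyCount_cycleGraph_le {V : Type*} [Fintype V] {ℓ : ℕ} [NeZero ℓ] (hℓ : 3 ≤ ℓ)
    (G : SimpleGraph V) (M : ℕ) (hM : ∀ col : V → ZMod ℓ, (coloredCycles G col).card ≤ M) :
    G.labelledCopyCount (SimpleGraph.cycleGraph ℓ) ≤ ℓ ^ ℓ * M := by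
  let I : Finset (ZMod ℓ → V) := {x | Function.Injective x ∧ ∀ i, G.Adj (x i) (x (i + 1))}
  have h1 : G.labelledCopyCount (SimpleGraph.cycleGraph ℓ) ≤ I.card := by
    refine labelledCopyCount_le_card (fun f i => f ((SimpleGraph.finEquivZMod ℓ).symm i)) ?_ ?_
    · intro f f' h
      ext a
      simpa using congrFun h (SimpleGraph.finEquivZMod ℓ a)
    · exact fun f => Finset.mem_filter.2 ⟨Finset.mem_univ _,
        f.injective.comp (SimpleGraph.finEquivZMod ℓ).symm.injective,
        SimpleGraph.Copy.zmod_adj hℓ f⟩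
  refine h1.trans ?_
  have hpos : 0 < Fintype.card (V → ZMod ℓ) := Fintype.card_pos
  refine Nat.le_of_mul_le_mul_left ?_ hpos
  calc Fintype.card (V → ZMod ℓ) * I.card = ∑ _x ∈ I, Fintype.card (V → ZMod ℓ) := by
        rw [Finset.sum_const, smul_eq_mul, mul_comm]
    _ ≤ ∑ x ∈ I, (Finset.univ.filter fun col : V → ZMod ℓ => ∀ i, col (x i) = i).card * ℓ ^ ℓ :=
        Finset.sum_le_sum fun x hx => card_colorings_le (Finset.mem_filter.1 hx).2.1
    _ = (∑ col : V → ZMod ℓ, (I.filter fun x => ∀ i, col (x i) = i).card) * ℓ ^ ℓ := by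
        rw [← Finset.sum_mul]
        congr 1
        exact Finset.sum_card_bipartiteAbove_eq_sum_card_bipartiteBelow
          (fun (x : ZMod ℓ → V) (col : V → ZMod ℓ) => ∀ i, col (x i) = i)
    _ ≤ (∑ _col : V → ZMod ℓ, M) * ℓ ^ ℓ := by
        refine Nat.mul_le_mul_right _ (Finset.sum_le_sum fun col _ => ?_)
        refine (Finset.card_le_card fun x hx => ?_).trans (hM col)
        rw [Finset.mem_filter] at hx
        exact mem_coloredCycles.2 ⟨hx.2, (Finset.mem_filter.1 hx.1).2.2⟩
    _ = _ := by
        rw [Finset.sum_const, smul_eq_mul, Finset.card_univ]; ring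

theorem generalizedTuranNumber_cycleGraph_isBigO {ℓ k : ℕ} (hℓ : 6 ≤ ℓ) (hk : 3 ≤ k)
    (hk3 : k = 3 → 3 ∣ ℓ) :
    (fun n : ℕ =>
        (generalizedTuranNumber n (SimpleGraph.cycleGraph ℓ) (cycleFamily k) : ℝ))
      =O[atTop] (fun n : ℕ => (n : ℝ) ^ (ℓ / 3)) := by
  have : NeZero ℓ := ⟨by omega⟩
  set C := fatThreshold (20 * k + 20) (28 * ℓ) 4
  refine IsBigO.of_bound
    ((ℓ ^ ℓ * (2 * (2 ^ ℓ * 6 ^ ℓ * C ^ (ℓ / 3))) : ℕ) : ℝ) ?_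
  filter_upwards [eventually_ge_atTop 1] with n hn
  have : Nonempty (Fin n) := ⟨⟨0, hn⟩⟩
  have h : generalizedTuranNumber n (SimpleGraph.cycleGraph ℓ) (cycleFamily k) ≤
      ℓ ^ ℓ * (2 * (2 ^ ℓ * 6 ^ ℓ * C ^ (ℓ / 3))) * n ^ (ℓ / 3) := by
    refine Finset.sup_le fun G hG => ?_
    have hG : IsFamilyFree (cycleFamily k) G := by simpa using hG
    have h4 := hG ⟨4, SimpleGraph.cycleGraph 4⟩ (Or.inl rfl)
    have h2k := hG ⟨2 * k, SimpleGraph.cycleGraph (2 * k)⟩ (Or.inr rfl)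
    refine SimpleGraph.copyCount_le_labelledCopyCount.trans
      ((labelledCopyCount_cycleGraph_le (by omega) G _ fun col =>
        card_coloredCycles_le hℓ hk hk3 h4 h2k).trans (le_of_eq ?_))
    rw [Fintype.card_fin, mul_pow]
    ring
  rw [Real.norm_of_nonneg (by positivity), Real.norm_of_nonneg (by positivity)]
  exact_mod_cast h

theorem proposition12 (ℓ k : ℕ) (hℓ : 6 ≤ ℓ) (hk : 3 ≤ k) (hk3 : k = 3 → 3 ∣ ℓ) :
    ((fun n : ℕ =>
        (generalizedTuranNumber n (SimpleGraph.cycleGraph ℓ) (cycleFamily k) : ℝ))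
      =O[atTop] (fun n : ℕ => (n : ℝ) ^ (ℓ / 3))) ∧
    (ℓ ≠ 2 * k → 2 * k ≠ 6 →
      (fun n : ℕ =>
        (generalizedTuranNumber n (SimpleGraph.cycleGraph ℓ) (cycleFamily k) : ℝ))
      =Θ[atTop] (fun n : ℕ => (n : ℝ) ^ (ℓ / 3))) :=
  ⟨generalizedTuranNumber_cycleGraph_isBigO hℓ hk hk3, fun hne h6 =>
    ⟨generalizedTuranNumber_cycleGraph_isBigO hℓ hk hk3,
      isBigO_generalizedTuranNumber_cycleGraph hℓ (by omega) hne⟩⟩
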